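/- Let $t\ge 1$, let $\mathfrak{FL}_2$ be the free complex Lie algebra on two generators, let $\mathfrak{FL}_2^{t+1}$ be the ideal spanned by the brackets of length at least $t+1$, and let $\mathfrak{n}_{2,t}=\mathfrak{FL}_2/\mathfrak{FL}_2^{t+1}$, generated by the images $x_1,x_2$ of the free generators. Write $\mathfrak{m}=\mathrm{span}\langle x_1,x_2\rangle$ and let $\mathfrak{m}^k$ be the span of the left-normed brackets $[\dots[x_{i_1},x_{i_2}],\dots,x_{i_k}]$. For $j\ge 1$ let $\mathrm{Der}_j\,\mathfrak{n}_{2,t}$ be the space of derivations $D$ of $\mathfrak{n}_{2,t}$ with $D(\mathfrak{m})\subseteq\mathfrak{m}^j$; let $\mathrm{Der}_1^0\,\mathfrak{n}_{2,t}=[\mathrm{Der}_1\,\mathfrak{n}_{2,t},\mathrm{Der}_1\,\mathfrak{n}_{2,t}]$ and $\mathfrak{N}_{2,t}=\sum_{2\le j\le t}\mathrm{Der}_j\,\mathfrak{n}_{2,t}$, and let $id_{2,t}$ be the derivation of $\mathfrak{n}_{2,t}$ that extends the identity map of $\mathfrak{m}$. Let $\mathfrak{g}_{2,t}=\mathrm{Der}_1^0\,\mathfrak{n}_{2,t}\oplus_{id}\mathfrak{n}_{2,t}$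 be the semidirect sum with $[d,a]=d(a)$ for $d\in\mathrm{Der}_1^0\,\mathfrak{n}_{2,t}$ and $a\in\mathfrak{n}_{2,t}$. Let $\mathfrak{g}$ be a nonsolvable finite-dimensional complex Lie algebra whose nilradical (largest nilpotent ideal) is isomorphic to $\mathfrak{n}_{2,t}$. Then, up to isomorphism, $\mathfrak{g}$ is one of the following Lie algebras: a) $\mathfrak{g}=\mathfrak{s}\oplus\mathfrak{r}$, a direct sum of ideals, where $\mathfrak{s}$ is a nonzero semisimple Lie algebra and $\mathfrak{r}$ is a solvable Lie algebra with nilradical isomorphic to $\mathfrak{n}_{2,t}$; b) $\mathfrak{g}=\mathfrak{s}\oplus\mathfrak{g}_{2,t}$, a direct sum of ideals, where $\mathfrak{s}$ is zero or semisimple; c) $\mathfrak{g}=\mathfrak{s}\oplus\mathfrak{g}(\delta)$, a direct sum of ideals, where $\mathfrak{s}$ is zero or semisimple and, for some $\delta\in\mathfrak{N}_{2,t}$ that commutes with every element of $\mathrm{Der}_1^0\,\mathfrak{n}_{2,t}$, $\mathfrak{g}(\delta)=\mathfrak{g}_{2,t}\oplus\mathbb{C}\cdot x$ is the Lie algebra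 that contains $\mathfrak{g}_{2,t}$ as an ideal, with $[\mathrm{Der}_1^0\,\mathfrak{n}_{2,t},x]=0$ and $[x,a]=(id_{2,t}+\delta)(a)$ for all $a\in\mathfrak{n}_{2,t}$. -/

import Mathlib

noncomputable section

namespace FreeNilExt

open LieAlgebra

/-- The nilradical of a Lie algebra: the sum of all ideals that are nilpotent as Lie algebras
(in finite dimension, the largest nilpotent ideal). It is not `LieAlgebra.maxNilpotentIdeal`, which
only takes the ideals on which the whole algebra acts nilpotently. -/
def nilradical (L : Type*) [LieRing L] [LieAlgebra ℂ L] : LieIdeal ℂ L :=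
  sSup {I : LieIdeal ℂ L | LieRing.IsNilpotent I}

/-- The free Lie algebra on two generators. -/
abbrev FL : Type := FreeLieAlgebra ℂ (Fin 2)

/-- The ideal spanned by the brackets of length at least `t + 1` (Mathlib numbers the lower central
series from `0`). -/
abbrev FLpow (t : ℕ) : LieIdeal ℂ FL := LieModule.lowerCentralSeries ℂ FL FL t

/-- The free nilpotent Lie algebra `𝔫_{2,t}` of type 2 and nilindex `t`. -/
abbrev N (t : ℕ) : Type := FL ⧸ FLpow t

/-- The quotient map. -/
def mkN (t : ℕ) : FL →ₗ⁅ℂ⁆ N t :=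
  { (LieSubmodule.Quotient.mk' (FLpow t) : FL →ₗ[ℂ] N t) with
    map_lie' := fun {x y} => LieSubmodule.Quotient.mk_bracket (FLpow t) x y }

theorem mkN_surjective (t : ℕ) : Function.Surjective (mkN t) :=
  LieSubmodule.Quotient.surjective_mk' (FLpow t)

theorem mkN_eq_zero {t : ℕ} {u : FL} : mkN t u = 0 ↔ u ∈ FLpow t :=
  LieSubmodule.Quotient.mk_eq_zero (FLpow t)

/-- The generators `x₁, x₂` of `𝔫_{2,t}`. -/
def gen (t : ℕ) (i : Fin 2) : N t := mkN t (FreeLieAlgebra.of ℂ i)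

/-- The homogeneous component `𝔪^k`: the span of the left-normed brackets
`[…[[x_{i₁}, x_{i₂}], x_{i₃}], …, x_{i_k}]` in the generators. -/
def homog (t k : ℕ) : Submodule ℂ (N t) :=
  Submodule.span ℂ {a | ∃ (i : Fin 2) (l : List (Fin 2)), l.length + 1 = k ∧
    l.foldl (fun b j => ⁅b, gen t j⁆) (gen t i) = a}

theorem gen_mem (t : ℕ) (i : Fin 2) : gen t i ∈ homog t 1 :=
  Submodule.subset_span ⟨i, [], rfl, rfl⟩

theorem homog_one (t : ℕ) : homog t 1 = Submodule.span ℂ (Set.range (gen t)) := by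
  unfold homog
  congr 1
  ext a
  constructor
  · rintro ⟨i, l, hl, rfl⟩
    obtain rfl : l = [] := List.length_eq_zero_iff.mp (by omega)
    exact ⟨i, rfl⟩
  · rintro ⟨i, rfl⟩
    exact ⟨i, [], rfl, rfl⟩

/-- `Der 𝔫_{2,t}`. -/
abbrev Der (t : ℕ) : Type := LieDerivation ℂ (N t) (N t)

theorem lowerCentralSeries_eq_bot (t : ℕ) : LieModule.lowerCentralSeries ℂ (N t) (N t) t = ⊥ := by
  rw [← LieIdeal.lowerCentralSeries_map_eq t (mkN_surjective t), LieIdeal.map_eq_bot_iff]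
  intro u hu
  exact LieHom.mem_ker.mpr (mkN_eq_zero.mpr hu)

/-- The auxiliary Lie algebra `𝔫 ⊕ ε𝔫` with `ε² = 0`: a derivation of `𝔫` is the `ε`-part of a
homomorphism into it. -/
abbrev Dual (t : ℕ) : Type :=
  LieAlgebra.ofTwoCocycle (0 : LieModule.Cohomology.twoCocycle ℂ (N t) (N t))

theorem dual_lie_fst {t : ℕ} (p q : Dual t) : ⁅p, q⁆.carrier.1 = ⁅p.carrier.1, q.carrier.1⁆ := rfl

theorem dual_lie_snd {t : ℕ} (p q : Dual t) :
    ⁅p, q⁆.carrier.2 = ⁅p.carrier.1, q.carrier.2⁆ - ⁅q.carrier.1, p.carrier.2⁆ := by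
  change (0 : N t) + ⁅p.carrier.1, q.carrier.2⁆ - ⁅q.carrier.1, p.carrier.2⁆ = _
  rw [zero_add]

/-- The homomorphism `x_i ↦ x_i + ε f(i)`. -/
def dualLift (t : ℕ) (f : Fin 2 → N t) : FL →ₗ⁅ℂ⁆ Dual t :=
  FreeLieAlgebra.lift ℂ (fun i => (⟨(gen t i, f i)⟩ : Dual t))

theorem dualLift_of (t : ℕ) (f : Fin 2 → N t) (i : Fin 2) :
    dualLift t f (FreeLieAlgebra.of ℂ i) = ⟨(gen t i, f i)⟩ :=
  FreeLieAlgebra.lift_of_apply _ _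

/-- The projection of the auxiliary algebra to its first component. -/
def dualFst (t : ℕ) : Dual t →ₗ⁅ℂ⁆ N t where
  toFun p := p.carrier.1
  map_add' _ _ := rfl
  map_smul' _ _ := rfl
  map_lie' := rfl

theorem dualLift_fst (t : ℕ) (f : Fin 2 → N t) (u : FL) :
    (dualLift t f u).carrier.1 = mkN t u := by
  have h : (dualFst t).comp (dualLift t f) = mkN t := by
    apply FreeLieAlgebra.hom_ext
    intro i
    rw [LieHom.comp_apply, dualLift_of]
    rfl
  exact LieHom.congr_fun h u

theorem dualLift_snd_mem (t : ℕ) (f : Fin 2 → N t) (k : ℕ) :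
    ∀ u ∈ LieModule.lowerCentralSeries ℂ FL FL k,
      (dualLift t f u).carrier.2 ∈ LieModule.lowerCentralSeries ℂ (N t) (N t) k := by
  induction k with
  | zero => intro u _; simp
  | succ k ih =>
    intro u hu
    rw [LieModule.lowerCentralSeries_succ, ← LieSubmodule.mem_toSubmodule,
      LieSubmodule.lieIdeal_oper_eq_linear_span'] at hu
    rw [LieModule.lowerCentralSeries_succ]
    induction hu using Submodule.span_induction with
    | mem w hw =>
      obtain ⟨a, -, b, hb, rfl⟩ := hw
      rw [LieHom.map_lie, dual_lie_snd]
      apply sub_mem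
      · exact LieSubmodule.lie_mem_lie (LieSubmodule.mem_top _) (ih b hb)
      · rw [← lie_skew]
        refine neg_mem (LieSubmodule.lie_mem_lie (LieSubmodule.mem_top _) ?_)
        rw [dualLift_fst, ← LieIdeal.lowerCentralSeries_map_eq k (mkN_surjective t)]
        exact LieIdeal.mem_map hb
    | zero => rw [map_zero]; exact zero_mem _
    | add a b _ _ ha hb => rw [map_add]; exact add_mem ha hb
    | smul c a _ ha => rw [map_smul]; exact SMulMemClass.smul_mem c ha

/-- The `ε`-part of `dualLift` as a linear map. -/
def dualLiftSnd (t : ℕ) (f : Fin 2 → N t) : FL →ₗ[ℂ] N t where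
  toFun u := (dualLift t f u).carrier.2
  map_add' a b := by rw [map_add]; rfl
  map_smul' c a := by rw [map_smul]; rfl

theorem dualLiftSnd_eq_zero (t : ℕ) (f : Fin 2 → N t) :
    (FLpow t).toSubmodule ≤ LinearMap.ker (dualLiftSnd t f) := by
  intro u hu
  have h := dualLift_snd_mem t f t u hu
  rw [lowerCentralSeries_eq_bot] at h
  exact h

/-- The derivation of `𝔫_{2,t}` extending prescribed values `x_i ↦ f(i)` on the generators. -/
def extendDer (t : ℕ) (f : Fin 2 → N t) : Der t where
  toLinearMap := (FLpow t).toSubmodule.liftQ (dualLiftSnd t f) (dualLiftSnd_eq_zero t f)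
  leibniz' a b := by
    obtain ⟨a, rfl⟩ := mkN_surjective t a
    obtain ⟨b, rfl⟩ := mkN_surjective t b
    rw [← LieHom.map_lie]
    change (dualLift t f ⁅a, b⁆).carrier.2 =
      ⁅mkN t a, (dualLift t f b).carrier.2⁆ - ⁅mkN t b, (dualLift t f a).carrier.2⁆
    rw [LieHom.map_lie, dual_lie_snd, dualLift_fst, dualLift_fst]

theorem extendDer_gen (t : ℕ) (f : Fin 2 → N t) (i : Fin 2) : extendDer t f (gen t i) = f i := by
  change (dualLift t f (FreeLieAlgebra.of ℂ i)).carrier.2 = f i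
  rw [dualLift_of]

theorem der_ext {t : ℕ} {D E : Der t} (h : ∀ i, D (gen t i) = E (gen t i)) : D = E := by
  let S : LieSubalgebra ℂ (N t) :=
    { LinearMap.eqLocus (D : N t →ₗ[ℂ] N t) (E : N t →ₗ[ℂ] N t) with
      lie_mem' := fun {a b} ha hb => by
        change D ⁅a, b⁆ = E ⁅a, b⁆
        have ha' : D a = E a := ha
        have hb' : D b = E b := hb
        rw [LieDerivation.apply_lie_eq_sub, LieDerivation.apply_lie_eq_sub, ha', hb'] }
  let φ : FL →ₗ⁅ℂ⁆ S := FreeLieAlgebra.lift ℂ (fun i => (⟨gen t i, h i⟩ : S))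
  have hφ : S.incl.comp φ = mkN t := by
    apply FreeLieAlgebra.hom_ext
    intro i
    rw [LieHom.comp_apply, FreeLieAlgebra.lift_of_apply]
    rfl
  ext a
  obtain ⟨u, rfl⟩ := mkN_surjective t a
  rw [← hφ]
  exact (φ u).2

/-- `id_{2,t}`: the derivation extending the identity map of `𝔪`. -/
def idDer (t : ℕ) : Der t := extendDer t (gen t)

theorem idDer_of_mem {t : ℕ} {a : N t} (ha : a ∈ homog t 1) : idDer t a = a := by
  rw [homog_one] at ha
  induction ha using Submodule.span_induction with
  | mem w hw => obtain ⟨i, rfl⟩ := hw; exact extendDer_gen t _ i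
  | zero => exact map_zero _
  | add a b _ _ ha hb => rw [map_add, ha, hb]
  | smul c a _ ha => rw [map_smul, ha]

/-- `Der_j 𝔫_{2,t}`: the derivations that map `𝔪` into `𝔪^j`, that is, the extensions of the linear
maps `𝔪 → 𝔪^j`. -/
def derHomog (t j : ℕ) : Submodule ℂ (Der t) where
  carrier := {D | ∀ a ∈ homog t 1, D a ∈ homog t j}
  add_mem' hD hE a ha := add_mem (hD a ha) (hE a ha)
  zero_mem' _ _ := zero_mem _
  smul_mem' c _ hD a ha := Submodule.smul_mem _ c (hD a ha)

/-- `Der_1 𝔫_{2,t}` as a Lie subalgebra of `Der 𝔫_{2,t}`. -/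
def derOne (t : ℕ) : LieSubalgebra ℂ (Der t) :=
  { derHomog t 1 with
    lie_mem' := fun {D E} hD hE a ha => by
      rw [LieDerivation.lie_apply]
      exact sub_mem (hD _ (hE a ha)) (hE _ (hD a ha)) }

/-- `Der_1^0 𝔫_{2,t} = [Der_1 𝔫_{2,t}, Der_1 𝔫_{2,t}]`, the derived algebra of `Der_1 𝔫_{2,t}`. -/
def derOneZero (t : ℕ) : LieSubalgebra ℂ (Der t) :=
  LieSubalgebra.map (derOne t).incl
    (LieIdeal.toLieSubalgebra ℂ (derOne t) (derivedSeries ℂ (derOne t) 1))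

theorem derOneZero_le (t : ℕ) : derOneZero t ≤ derOne t := by
  rintro _ ⟨D, -, rfl⟩
  exact D.2

/-- `𝔑_{2,t} = ⨁_{2 ≤ j ≤ t} Der_j 𝔫_{2,t}`. -/
def nilDer (t : ℕ) : Submodule ℂ (Der t) :=
  ⨆ j ∈ Finset.Icc 2 t, derHomog t j

/-- The derivation centralizes `Der_1^0 𝔫_{2,t}`. -/
def Centralizes (t : ℕ) (D : Der t) : Prop :=
  ∀ d ∈ derOneZero t, ⁅d, D⁆ = 0

theorem idDer_centralizes (t : ℕ) : Centralizes t (idDer t) := by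
  intro d hd
  apply der_ext
  intro i
  rw [LieDerivation.lie_apply, idDer_of_mem (gen_mem t i),
    idDer_of_mem (derOneZero_le t hd _ (gen_mem t i)), sub_self]
  rfl

/-- `𝔤_{2,t} = Der_1^0 𝔫_{2,t} ⊕_{id} 𝔫_{2,t}`: the semidirect sum in which `[d, a] = d(a)`. -/
abbrev G (t : ℕ) : Type := SemiDirectSum (N t) (derOneZero t) (derOneZero t).incl

/-- The derivation of `𝔤_{2,t}` that vanishes on `Der_1^0 𝔫_{2,t}` and acts on `𝔫_{2,t}` as a given
derivation `D` centralizing `Der_1^0 𝔫_{2,t}`. -/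
def liftDer (t : ℕ) (D : Der t) (hD : Centralizes t D) : LieDerivation ℂ (G t) (G t) where
  toFun p := ⟨D p.left, 0⟩
  map_add' p q := by simp
  map_smul' c p := by simp
  leibniz' p q := by
    have h1 : ∀ (d : derOneZero t) (a : N t), (d : Der t) (D a) = D ((d : Der t) a) := by
      intro d a
      have := LieDerivation.congr_fun (hD d d.2) a
      rw [LieDerivation.lie_apply] at this
      exact sub_eq_zero.mp this
    ext
    · simp only [SemiDirectSum.lie_eq_mk, SemiDirectSum.sub_eq_mk,
        LinearMap.coe_mk, AddHom.coe_mk, map_add, map_sub, map_zero, LieDerivation.apply_lie_eq_sub,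
        LieSubalgebra.coe_incl, h1, LieDerivation.zero_apply]
      abel
    · simp

/-- The one-dimensional extension `L ⊕ ℂ x` of a Lie algebra in which `[x, a] = D(a)`; a pair
`(a, c)` stands for `a + c x`. -/
def OneExt {L : Type*} [LieRing L] [LieAlgebra ℂ L] (_ : LieDerivation ℂ L L) : Type _ := L × ℂ

section OneExt

variable {L : Type*} [LieRing L] [LieAlgebra ℂ L] (D : LieDerivation ℂ L L)

instance : AddCommGroup (OneExt D) := inferInstanceAs (AddCommGroup (L × ℂ))

instance : Module ℂ (OneExt D) := inferInstanceAs (Module ℂ (L × ℂ))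

instance : Bracket (OneExt D) (OneExt D) where
  bracket p q := (⁅p.1, q.1⁆ + p.2 • D q.1 - q.2 • D p.1, 0)

theorem oneExt_lie (p q : OneExt D) :
    ⁅p, q⁆ = ((⁅p.1, q.1⁆ + p.2 • D q.1 - q.2 • D p.1, 0) : L × ℂ) := rfl

instance : LieRing (OneExt D) where
  add_lie p q r := by
    refine Prod.ext ?_ (add_zero (0 : ℂ)).symm
    change ⁅p.1 + q.1, r.1⁆ + (p.2 + q.2) • D r.1 - r.2 • D (p.1 + q.1) =
      (⁅p.1, r.1⁆ + p.2 • D r.1 - r.2 • D p.1) + (⁅q.1, r.1⁆ + q.2 • D r.1 - r.2 • D q.1)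
    rw [add_lie, add_smul, map_add, smul_add]
    abel
  lie_add p q r := by
    refine Prod.ext ?_ (add_zero (0 : ℂ)).symm
    change ⁅p.1, q.1 + r.1⁆ + p.2 • D (q.1 + r.1) - (q.2 + r.2) • D p.1 =
      (⁅p.1, q.1⁆ + p.2 • D q.1 - q.2 • D p.1) + (⁅p.1, r.1⁆ + p.2 • D r.1 - r.2 • D p.1)
    rw [lie_add, add_smul, map_add, smul_add]
    abel
  lie_self p := by
    refine Prod.ext ?_ rfl
    change ⁅p.1, p.1⁆ + p.2 • D p.1 - p.2 • D p.1 = 0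
    rw [lie_self, zero_add, sub_self]
  leibniz_lie p q r := by
    refine Prod.ext ?_ (add_zero (0 : ℂ)).symm
    change ⁅p.1, ⁅q.1, r.1⁆ + q.2 • D r.1 - r.2 • D q.1⁆ +
        p.2 • D (⁅q.1, r.1⁆ + q.2 • D r.1 - r.2 • D q.1) - (0 : ℂ) • D p.1 =
      (⁅⁅p.1, q.1⁆ + p.2 • D q.1 - q.2 • D p.1, r.1⁆ + (0 : ℂ) • D r.1 -
        r.2 • D (⁅p.1, q.1⁆ + p.2 • D q.1 - q.2 • D p.1)) +
      (⁅q.1, ⁅p.1, r.1⁆ + p.2 • D r.1 - r.2 • D p.1⁆ +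
        q.2 • D (⁅p.1, r.1⁆ + p.2 • D r.1 - r.2 • D p.1) - (0 : ℂ) • D q.1)
    simp only [lie_add, lie_sub, add_lie, sub_lie, lie_smul, smul_lie, map_add, map_sub, map_smul,
      LieDerivation.apply_lie_eq_add, smul_add, smul_sub, zero_smul, smul_smul]
    rw [leibniz_lie p.1 q.1 r.1, ← lie_skew (D p.1) q.1, mul_comm q.2 p.2, mul_comm r.2 p.2, mul_comm r.2 q.2]
    simp only [smul_neg]
    abel

instance : LieAlgebra ℂ (OneExt D) where
  lie_smul c p q := by
    refine Prod.ext ?_ (smul_zero c).symm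
    change ⁅p.1, c • q.1⁆ + p.2 • D (c • q.1) - (c * q.2) • D p.1 =
      c • (⁅p.1, q.1⁆ + p.2 • D q.1 - q.2 • D p.1)
    rw [lie_smul, map_smul, smul_sub, smul_add, smul_smul, smul_smul, smul_smul, mul_comm p.2 c]

end OneExt

theorem centralizes_add {t : ℕ} {D E : Der t} (hD : Centralizes t D) (hE : Centralizes t E) :
    Centralizes t (D + E) := fun d hd => by
  rw [lie_add, hD d hd, hE d hd, add_zero]

/-- `𝔤(δ) = 𝔤_{2,t} ⊕ ℂ x` with `[Der_1^0 𝔫_{2,t}, x] = 0` and `ad x = id_{2,t} + δ` on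
`𝔫_{2,t}`. -/
abbrev GDelta (t : ℕ) (δ : Der t) (hδ : Centralizes t δ) : Type :=
  OneExt (liftDer t (idDer t + δ) (centralizes_add (idDer_centralizes t) hδ))

end FreeNilExt

end

/-! Let `n` be the nilradical and `C` its centralizer. A solvable ideal inside `C` lies in `n`, so
by Cartan's criterion `C / (C ∩ n)` is semisimple; moreover `C ∩ n` is central in `C`. A central
extension of a semisimple algebra splits, hence `S = [C, C]` is a semisimple ideal, and `g = S ⊕ H`
with `H` the Killing complement of `S`. Here `H` contains `n`, and `n` contains its centralizer in
`H` (`exists_isCompl_of_forall_isNilpotent_le`).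

In `H` the action on `n / [n, n] = ℂ²` gives matrices whose kernel is exactly `n`: elements acting
trivially on the abelianization form a nilpotent ideal (`actMatrix_eq_zero_iff`). So `H / n` embeds
in `gl₂`, and if `H` is not solvable the image contains `sl₂`. Two cohomological facts, both proved
with the Casimir operator, make this exact. The vanishing of `H²` lifts the triple `e, f, h` from `H
/ n` to `H` (`exists_sl2_lift`). Complete reducibility (`exists_invariant`) replaces `x₁, x₂` by
generators whose span the triple preserves; since the algebra is free nilpotent, the change of
generators is an automorphism (`exists_isStandardTriple`). The triple then acts as `Der_1^0`.

If every matrix has trace zero, `H` is spanned by the triple and `n`, which is `𝔤_{2,t}`. Otherwise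
some element acts on the abelianization as the identity; it is central modulo `n`, so complete
reducibility again makes it commute with the triple. It acts on `n` as `id + δ`, where `δ` vanishes
on the abelianization and so lies in `𝔑_{2,t}`. -/

noncomputable section

namespace FreeNilExt

open LieAlgebra

/-! ### Fitting decomposition and nilpotent operators -/

/-- The Fitting decomposition, with a positive exponent. -/
theorem exists_pos_isCompl_ker_pow_range_pow {V : Type*} [AddCommGroup V] [Module ℂ V]
    [FiniteDimensional ℂ V] (u : Module.End ℂ V) :
    ∃ k, 0 < k ∧ IsCompl (LinearMap.ker (u ^ k)) (LinearMap.range (u ^ k)) := by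
  obtain ⟨k, hk, hk'⟩ := (u.eventually_isCompl_ker_pow_range_pow.and
    (Filter.eventually_gt_atTop 0)).exists
  exact ⟨k, hk', hk⟩

theorem ker_le_ker_pow {V : Type*} [AddCommGroup V] [Module ℂ V] {u : Module.End ℂ V} {k : ℕ}
    (hk : 0 < k) : LinearMap.ker u ≤ LinearMap.ker (u ^ k) := by
  intro v hv
  obtain ⟨j, rfl⟩ := Nat.exists_eq_succ_of_ne_zero hk.ne'
  rw [LinearMap.mem_ker, Nat.succ_eq_add_one, pow_succ, Module.End.mul_apply, hv, map_zero]

/-- Write `x = u^k z`. The component of `z` in the kernel of `u^k` does not contribute, so `z` may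
be taken in the range, and one factor `u` is split off. -/
theorem exists_mem_range_pow_apply_eq {V : Type*} [AddCommGroup V] [Module ℂ V]
    {u : Module.End ℂ V} {k : ℕ} (hk : 0 < k)
    (hc : IsCompl (LinearMap.ker (u ^ k)) (LinearMap.range (u ^ k))) {x : V}
    (hx : x ∈ LinearMap.range (u ^ k)) : ∃ y ∈ LinearMap.range (u ^ k), u y = x := by
  obtain ⟨z, rfl⟩ := hx
  obtain ⟨p, q, hp, ⟨s, rfl⟩, rfl⟩ := Submodule.codisjoint_iff_exists_add_eq.mp hc.codisjoint z
  obtain ⟨j, rfl⟩ := Nat.exists_eq_succ_of_ne_zero hk.ne'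
  refine ⟨(u ^ j) ((u ^ (j + 1)) s), ⟨(u ^ j) s, ?_⟩, ?_⟩
  · rw [← Module.End.mul_apply, ← Module.End.mul_apply, ← pow_add, ← pow_add]
    congr 2
    simp [add_comm]
  · rw [map_add, LinearMap.mem_ker.mp hp, zero_add, ← Module.End.mul_apply, ← pow_succ']

/-- On a nonzero Fitting range `u` would have an eigenvector; its eigenvalue being zero, it would
also lie in the Fitting kernel. -/
theorem isNilpotent_of_eigenvalue_eq_zero {V : Type*} [AddCommGroup V] [Module ℂ V]
    [FiniteDimensional ℂ V] {u : Module.End ℂ V}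
    (hu : ∀ μ, u.HasEigenvalue μ → μ = 0) : IsNilpotent u := by
  obtain ⟨k, hpos, hk⟩ := exists_pos_isCompl_ker_pow_range_pow u
  refine ⟨k, ?_⟩
  rw [← LinearMap.range_eq_bot]
  by_contra hne
  have hs : ∀ x ∈ LinearMap.range (u ^ k), u x ∈ LinearMap.range (u ^ k) := by
    rintro _ ⟨x, rfl⟩
    exact ⟨u x, by rw [← Module.End.mul_apply, ← Module.End.mul_apply, ← pow_succ, ← pow_succ']⟩
  have : Nontrivial (LinearMap.range (u ^ k)) := Submodule.nontrivial_iff_ne_bot.mpr hne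
  obtain ⟨μ, hμ⟩ := Module.End.exists_eigenvalue (u.restrict hs)
  obtain ⟨⟨v, hvr⟩, hv⟩ := hμ.exists_hasEigenvector
  have hv0 : v ≠ 0 := fun h0 => hv.2 (Subtype.ext h0)
  have huv : u v = μ • v := congrArg Subtype.val hv.apply_eq_smul
  have hμ0 : μ = 0 := hu μ (Module.End.hasEigenvalue_of_hasEigenvector
    (Module.End.hasEigenvector_iff.mpr ⟨Module.End.mem_eigenspace_iff.mpr huv, hv0⟩))
  rw [hμ0, zero_smul] at huv
  exact hv0 (Submodule.disjoint_def.mp hk.disjoint v (ker_le_ker_pow hpos huv) hvr)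

/-! ### Representations of `𝔰𝔩₂` through the Casimir operator -/

section Sl2

attribute [local instance 100] LieRing.ofAssociativeRing

/-- Operators `h, e, f` satisfying the defining relations of `𝔰𝔩₂`. -/
structure Sl2Rel {V : Type*} [AddCommGroup V] [Module ℂ V] (h e f : Module.End ℂ V) : Prop where
  ef : ∀ v, e (f v) = f (e v) + h v
  he : ∀ v, h (e v) = e (h v) + (2 : ℂ) • e v
  hf : ∀ v, h (f v) = f (h v) - (2 : ℂ) • f v

namespace Sl2Rel

variable {V : Type*} [AddCommGroup V] [Module ℂ V] {h e f : Module.End ℂ V}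

/-- This symmetry fixes the Casimir operator, so each statement about `e` or about upper bounds on
weights yields its mirror image. -/
theorem symm (r : Sl2Rel h e f) : Sl2Rel (-h) f e where
  ef v := by rw [r.ef, LinearMap.neg_apply]; abel
  he v := by simp only [LinearMap.neg_apply, r.hf, map_neg]; abel
  hf v := by simp only [LinearMap.neg_apply, r.he, map_neg]; abel

/-- The Casimir operator. -/
def casimir (h e f : Module.End ℂ V) : Module.End ℂ V :=
  e * f + f * e + (1 / 2 : ℂ) • (h * h)

theorem casimir_apply (v : V) :
    casimir h e f v = e (f v) + f (e v) + (1 / 2 : ℂ) • h (h v) := rfl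

theorem casimir_symm : casimir (-h) f e = casimir h e f := by
  ext v
  simp only [casimir_apply, LinearMap.neg_apply, map_neg, neg_neg]
  abel

theorem commute_h (r : Sl2Rel h e f) : Commute (casimir h e f) h := by
  ext v
  simp only [Module.End.mul_apply, casimir_apply, r.ef, r.he, r.hf, map_add, map_smul]
  module

theorem commute_e (r : Sl2Rel h e f) : Commute (casimir h e f) e := by
  ext v
  simp only [Module.End.mul_apply, casimir_apply, r.ef, r.he, map_add, map_smul]
  module

theorem commute_f (r : Sl2Rel h e f) : Commute (casimir h e f) f := by
  have := r.symm.commute_e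
  rwa [casimir_symm] at this

theorem exists_nat_of_primitive [FiniteDimensional ℂ V] (r : Sl2Rel h e f) {v : V} {μ : ℂ}
    (hv : v ≠ 0) (hh : h v = μ • v) (he : e v = 0) : ∃ n : ℕ, μ = n := by
  by_cases h0 : h = 0
  · refine ⟨0, ?_⟩
    rw [h0, LinearMap.zero_apply] at hh
    simpa [hv] using hh.symm
  · have t : IsSl2Triple h e f :=
      { h_ne_zero := h0
        lie_e_f := by
          ext v
          simp [LieRing.of_associative_ring_bracket, r.ef]
        lie_h_e_nsmul := by
          ext v
          simp [LieRing.of_associative_ring_bracket, r.he, two_smul]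
        lie_h_f_nsmul := by
          ext v
          simp [LieRing.of_associative_ring_bracket, r.hf, two_smul] }
    have P : t.HasPrimitiveVectorWith v μ := ⟨hv, hh, he⟩
    exact P.exists_nat

/-- If the Casimir operator is nilpotent, then every primitive vector has weight zero. -/
theorem weight_eq_zero_of_primitive [FiniteDimensional ℂ V] (r : Sl2Rel h e f)
    (hn : IsNilpotent (casimir h e f)) {v : V} {μ : ℂ}
    (hv : v ≠ 0) (hh : h v = μ • v) (he : e v = 0) : μ = 0 := by
  obtain ⟨n, rfl⟩ := r.exists_nat_of_primitive hv hh he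
  -- The Casimir operator acts on a primitive vector of weight `n` by `n (n + 2) / 2`, which must
  -- vanish.
  have h1 : casimir h e f v = ((n : ℂ) + (1 / 2) * (n * n)) • v := by
    rw [casimir_apply, r.ef, he, hh, map_smul, hh, map_zero]
    module
  have h2 : (casimir h e f).HasEigenvalue ((n : ℂ) + (1 / 2) * (n * n)) :=
    Module.End.hasEigenvalue_of_hasEigenvector
      (Module.End.hasEigenvector_iff.mpr ⟨Module.End.mem_eigenspace_iff.mpr h1, hv⟩)
  have h3 := (h2.isNilpotent_of_isNilpotent hn).eq_zero
  have h4 : ((n * (2 + n) : ℕ) : ℂ) = 0 := by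
    push_cast
    linear_combination 2 * h3
  have h5 := Nat.cast_eq_zero.mp h4
  have h6 : n = 0 := by
    rcases Nat.mul_eq_zero.mp h5 with h | h <;> omega
  rw [h6, Nat.cast_zero]

/-- Since `e` raises weights by 2, it kills an eigenvector whose eigenvalue has maximal real part;
that vector is primitive, so its weight is 0. An eigenvalue with real part 0 is then itself maximal.
-/
theorem re_nonpos_of_hasEigenvalue [FiniteDimensional ℂ V] (r : Sl2Rel h e f)
    (hn : IsNilpotent (casimir h e f)) {μ : ℂ} (hμ : h.HasEigenvalue μ) :
    μ.re < 0 ∨ μ = 0 := by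
  obtain ⟨ν, hν, hmax⟩ := Set.exists_max_image _ Complex.re h.finite_hasEigenvalue ⟨μ, hμ⟩
  have key : ∀ ν, h.HasEigenvalue ν → (∀ b, h.HasEigenvalue b → b.re ≤ ν.re) → ν = 0 := by
    intro ν hν hmax
    obtain ⟨v, hv⟩ := hν.exists_hasEigenvector
    have hhv : h v = ν • v := hv.apply_eq_smul
    refine r.weight_eq_zero_of_primitive hn hv.2 hhv ?_
    by_contra hev
    have h2 : h (e v) = (ν + 2) • e v := by rw [r.he, hhv, map_smul, add_smul]
    have := hmax (ν + 2) (Module.End.hasEigenvalue_of_hasEigenvector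
      (Module.End.hasEigenvector_iff.mpr ⟨Module.End.mem_eigenspace_iff.mpr h2, hev⟩))
    simp at this
    linarith
  have hν0 := key ν hν hmax
  have h1 := hmax μ hμ
  rw [hν0, Complex.zero_re] at h1
  rcases h1.lt_or_eq with h2 | h2
  · exact Or.inl h2
  · exact Or.inr (key μ hμ fun b hb => by
      have := hmax b hb
      rw [hν0, Complex.zero_re] at this
      rwa [h2])

theorem eigenvalue_eq_zero [FiniteDimensional ℂ V] (r : Sl2Rel h e f)
    (hn : IsNilpotent (casimir h e f)) {μ : ℂ} (hμ : h.HasEigenvalue μ) : μ = 0 := by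
  rcases r.re_nonpos_of_hasEigenvalue hn hμ with h1 | h1
  · have h2 : (-h).HasEigenvalue (-μ) := by
      obtain ⟨v, hv⟩ := hμ.exists_hasEigenvector
      refine Module.End.hasEigenvalue_of_hasEigenvector
        (Module.End.hasEigenvector_iff.mpr ⟨Module.End.mem_eigenspace_iff.mpr ?_, hv.2⟩)
      rw [LinearMap.neg_apply, hv.apply_eq_smul, neg_smul]
    rcases r.symm.re_nonpos_of_hasEigenvalue (by rwa [casimir_symm]) h2 with h3 | h3
    · simp at h3
      linarith
    · simpa using h3
  · exact h1

/-- All weights are zero, so `h` is nilpotent and 2 is not an eigenvalue. If `e (h v) = 0`, then `h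
(e v) = 2 e v` forces `e v = 0`; induction on the power of `h` that kills `v` finishes. -/
theorem e_eq_zero_of_isNilpotent_casimir [FiniteDimensional ℂ V] (r : Sl2Rel h e f)
    (hn : IsNilpotent (casimir h e f)) : e = 0 := by
  obtain ⟨k, hk⟩ := isNilpotent_of_eigenvalue_eq_zero fun μ hμ => r.eigenvalue_eq_zero hn hμ
  have hinj : ∀ v, h v = (2 : ℂ) • v → v = 0 := by
    intro v hv
    by_contra hv0
    have := r.eigenvalue_eq_zero hn (Module.End.hasEigenvalue_of_hasEigenvector
      (Module.End.hasEigenvector_iff.mpr ⟨Module.End.mem_eigenspace_iff.mpr hv, hv0⟩))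
    norm_num at this
  have hpow : ∀ j v, (h ^ j) v = 0 → e v = 0 := by
    intro j
    induction j with
    | zero => intro v hv; rw [pow_zero, Module.End.one_apply] at hv; rw [hv, map_zero]
    | succ j ih =>
      intro v hv
      rw [pow_succ, Module.End.mul_apply] at hv
      apply hinj
      rw [r.he, ih _ hv, zero_add]
  ext v
  exact hpow k v (by rw [hk, LinearMap.zero_apply])

/-- The Casimir operator commutes with the triple, so its generalized kernel is a submodule on which
it is nilpotent. -/
theorem e_apply_eq_zero [FiniteDimensional ℂ V] (r : Sl2Rel h e f) {k : ℕ} {x : V}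
    (hx : x ∈ LinearMap.ker (casimir h e f ^ k)) : e x = 0 := by
  have hs : ∀ u : Module.End ℂ V, Commute (casimir h e f) u →
      ∀ y ∈ LinearMap.ker (casimir h e f ^ k), u y ∈ LinearMap.ker (casimir h e f ^ k) := by
    intro u hu y hy
    rw [LinearMap.mem_ker, ← Module.End.mul_apply, (hu.pow_left k).eq, Module.End.mul_apply,
      LinearMap.mem_ker.mp hy, map_zero]
  have r' : Sl2Rel (h.restrict (hs h r.commute_h)) (e.restrict (hs e r.commute_e))
      (f.restrict (hs f r.commute_f)) :=
    ⟨fun v => Subtype.ext (r.ef v), fun v => Subtype.ext (r.he v), fun v => Subtype.ext (r.hf v)⟩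
  have hn : IsNilpotent (casimir (h.restrict (hs h r.commute_h)) (e.restrict (hs e r.commute_e))
      (f.restrict (hs f r.commute_f))) := by
    refine ⟨k, ?_⟩
    have hc : casimir (h.restrict (hs h r.commute_h)) (e.restrict (hs e r.commute_e))
      (f.restrict (hs f r.commute_f)) =
        (casimir h e f).restrict (hs (casimir h e f) (Commute.refl _)) := rfl
    rw [hc, Module.End.pow_restrict]
    ext v
    exact v.2
  exact congrArg Subtype.val (LinearMap.congr_fun (r'.e_eq_zero_of_isNilpotent_casimir hn) ⟨x, hx⟩)

theorem f_apply_eq_zero [FiniteDimensional ℂ V] (r : Sl2Rel h e f) {k : ℕ} {x : V}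
    (hx : x ∈ LinearMap.ker (casimir h e f ^ k)) : f x = 0 :=
  r.symm.e_apply_eq_zero (k := k) (by rwa [casimir_symm])

theorem h_apply_eq_zero [FiniteDimensional ℂ V] (r : Sl2Rel h e f) {k : ℕ} {x : V}
    (hx : x ∈ LinearMap.ker (casimir h e f ^ k)) : h x = 0 := by
  have := r.ef x
  rwa [r.f_apply_eq_zero hx, r.e_apply_eq_zero hx, map_zero, map_zero, zero_add, eq_comm] at this

/-- An element that is invariant modulo an invariant subspace `U` is congruent modulo `U` to an
invariant one. -/
theorem exists_invariant [FiniteDimensional ℂ V] (r : Sl2Rel h e f) (U : Submodule ℂ V)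
    (hU : ∀ u ∈ U, h u ∈ U) (eU : ∀ u ∈ U, e u ∈ U) (fU : ∀ u ∈ U, f u ∈ U) {x : V}
    (hx : h x ∈ U) (ex : e x ∈ U) (fx : f x ∈ U) :
    ∃ w ∈ U, h (x - w) = 0 ∧ e (x - w) = 0 ∧ f (x - w) = 0 := by
  have cU : ∀ u ∈ U, casimir h e f u ∈ U := fun u hu =>
    add_mem (add_mem (eU _ (fU _ hu)) (fU _ (eU _ hu))) (U.smul_mem _ (hU _ (hU _ hu)))
  have cx : casimir h e f x ∈ U :=
    add_mem (add_mem (eU _ fx) (fU _ ex)) (U.smul_mem _ (hU _ hx))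
  -- Splitting `casimir x` inside `U` as `z + casimir w`, with `z` killed by `casimir ^ k`, puts `x
  -- - w` in the generalized kernel of the Casimir operator, where the triple acts by zero.
  obtain ⟨k, hpos, hk⟩ := exists_pos_isCompl_ker_pow_range_pow ((casimir h e f).restrict cU)
  obtain ⟨z, y, hz, hy, hzy⟩ :=
    Submodule.codisjoint_iff_exists_add_eq.mp hk.codisjoint ⟨_, cx⟩
  obtain ⟨w, -, rfl⟩ := exists_mem_range_pow_apply_eq hpos hk hy
  have hz' : (casimir h e f ^ k) z = 0 := by
    have := congrArg Subtype.val (LinearMap.mem_ker.mp hz)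
    rwa [Module.End.pow_restrict] at this
  have hxw : x - w ∈ LinearMap.ker (casimir h e f ^ (k + 1)) := by
    have h1 : casimir h e f x = z + casimir h e f w := (congrArg Subtype.val hzy).symm
    rw [LinearMap.mem_ker, pow_succ, Module.End.mul_apply, map_sub, h1, add_sub_cancel_right, hz']
  exact ⟨w, w.2, r.h_apply_eq_zero hxw, r.e_apply_eq_zero hxw, r.f_apply_eq_zero hxw⟩

/-- The equations that make it possible to correct a lift of an `𝔰𝔩₂`-triple modulo an abelian
ideal (the vanishing of the second cohomology of `𝔰𝔩₂`). -/
theorem exists_correction [FiniteDimensional ℂ V] (r : Sl2Rel h e f) {a b : V} (hab : e b = f a) :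
    ∃ u v, a + h u + e (f u) - e (e v) = (2 : ℂ) • u ∧
      b + h v - f (e v) + f (f u) = -((2 : ℂ) • v) := by
  obtain ⟨k, hpos, hk⟩ := exists_pos_isCompl_ker_pow_range_pow (casimir h e f)
  obtain ⟨a₀, a₁, ha₀, ha₁, rfl⟩ := Submodule.codisjoint_iff_exists_add_eq.mp hk.codisjoint a
  obtain ⟨b₀, b₁, hb₀, hb₁, rfl⟩ := Submodule.codisjoint_iff_exists_add_eq.mp hk.codisjoint b
  obtain ⟨a', ha', rfl⟩ := exists_mem_range_pow_apply_eq hpos hk ha₁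
  obtain ⟨b', hb', rfl⟩ := exists_mem_range_pow_apply_eq hpos hk hb₁
  have fa := r.f_apply_eq_zero ha₀
  have ga := r.h_apply_eq_zero ha₀
  have eb := r.e_apply_eq_zero hb₀
  have fb := r.f_apply_eq_zero hb₀
  have gb := r.h_apply_eq_zero hb₀
  have hs : ∀ u : Module.End ℂ V, Commute (casimir h e f) u →
      ∀ y ∈ LinearMap.range (casimir h e f ^ k), u y ∈ LinearMap.range (casimir h e f ^ k) := by
    rintro u hu _ ⟨y, rfl⟩
    exact ⟨u y, by rw [← Module.End.mul_apply, (hu.pow_left k).eq, Module.End.mul_apply]⟩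
  -- The compatibility `e b = f a` passes to `a', b'` because the Casimir operator is injective on
  -- its Fitting range.
  have hab' : e b' = f a' := by
    rw [← sub_eq_zero]
    refine Submodule.disjoint_def.mp hk.disjoint _ (ker_le_ker_pow hpos ?_)
      (sub_mem (hs e r.commute_e _ hb') (hs f r.commute_f _ ha'))
    rw [LinearMap.mem_ker, map_sub, ← Module.End.mul_apply, ← Module.End.mul_apply,
      r.commute_e.eq, r.commute_f.eq, Module.End.mul_apply, Module.End.mul_apply, sub_eq_zero]
    rwa [map_add, map_add, eb, fa, zero_add, zero_add] at hab
  have eh : ∀ v, e (h v) = h (e v) - (2 : ℂ) • e v := fun v => by rw [r.he, add_sub_cancel_right]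
  have fh : ∀ v, f (h v) = h (f v) + (2 : ℂ) • f v := fun v => by rw [r.hf, sub_add_cancel]
  -- On the trivial part the equations read `a₀ = 2u` and `b₀ = -2v`. On the Fitting range, where `a
  -- = casimir a'` and `b = casimir b'`, the solution is `-h/2` applied to `a'` and `b'`.
  refine ⟨(1 / 2 : ℂ) • a₀ - (1 / 2 : ℂ) • h a', -((1 / 2 : ℂ) • b₀) - (1 / 2 : ℂ) • h b', ?_, ?_⟩
  · simp only [casimir_apply, map_add, map_sub, map_neg, map_smul, fa, ga, eb, eh, fh,
      r.ef, hab', map_zero, smul_zero]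
    module
  · simp only [casimir_apply, map_add, map_sub, map_neg, map_smul, fa, eb, gb, eh, fh,
      r.ef, hab', map_zero, smul_zero]
    module

end Sl2Rel
end Sl2

/-! ### Lifting `𝔰𝔩₂`-triples modulo a nilpotent ideal -/

section Lift

variable {L : Type*} [LieRing L] [LieAlgebra ℂ L] [FiniteDimensional ℂ L]

/-- Keeping `h = ⁅e, f⁆` exact leaves two errors `a, b` in `I`. Since `⁅n, I⁆ ≤ J`, the triple
satisfies the `𝔰𝔩₂` relations on `I / (I ∩ J)`, and the terms quadratic or cubic in `y, z` fall into
`J`. What remains is the linear system of `exists_correction`. -/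
theorem exists_sl2_lift_succ {n I J : LieIdeal ℂ L} (hIn : I ≤ n)
    (hnI : ⁅n, I⁆ ≤ J) {e f h : L} (hh : ⁅e, f⁆ = h) (he : ⁅h, e⁆ - (2 : ℂ) • e ∈ I)
    (hf : ⁅h, f⁆ + (2 : ℂ) • f ∈ I) :
    ∃ y ∈ I, ∃ z ∈ I, ⁅⁅e + y, f + z⁆, e + y⁆ - (2 : ℂ) • (e + y) ∈ J ∧
      ⁅⁅e + y, f + z⁆, f + z⁆ + (2 : ℂ) • (f + z) ∈ J := by
  let W : LieSubmodule ℂ L I :=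
    LieSubmodule.comap (LieSubmodule.incl I) J
  have hmk : ∀ y : I, (LieSubmodule.Quotient.mk y : I ⧸ W) = 0 ↔ (y : L) ∈ J := fun y =>
    Submodule.Quotient.mk_eq_zero W.toSubmodule
  have hmk' : ∀ y y' : I, (LieSubmodule.Quotient.mk y : I ⧸ W) = LieSubmodule.Quotient.mk y' ↔
      (y : L) - y' ∈ J := fun y y' => Submodule.Quotient.eq W.toSubmodule
  have hsurj : ∀ q : I ⧸ W, ∃ y : I, LieSubmodule.Quotient.mk y = q :=
    LieSubmodule.Quotient.surjective_mk' W
  have hIJ : ∀ {x y : L}, x ∈ n → y ∈ I → ⁅x, y⁆ ∈ J := fun hx hy =>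
    hnI (LieSubmodule.lie_mem_lie hx hy)
  have r : Sl2Rel (LieModule.toEnd ℂ L (I ⧸ W) h) (LieModule.toEnd ℂ L (I ⧸ W) e)
      (LieModule.toEnd ℂ L (I ⧸ W) f) := by
    refine ⟨fun q => ?_, fun q => ?_, fun q => ?_⟩ <;>
    obtain ⟨y, rfl⟩ := hsurj q <;>
    simp only [LieModule.toEnd_apply_apply]
    · rw [← hh, lie_lie]
      abel
    · rw [leibniz_lie, add_comm, add_right_inj, ← sub_eq_zero, ← smul_lie, ← sub_lie]
      exact (hmk ⟨⁅⁅h, e⁆ - (2 : ℂ) • e, (y : L)⁆, _⟩).mpr (hIJ (hIn he) y.2)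
    · rw [leibniz_lie, add_comm, sub_eq_add_neg, add_right_inj, ← sub_eq_zero, sub_neg_eq_add,
        ← smul_lie, ← add_lie]
      exact (hmk ⟨⁅⁅h, f⁆ + (2 : ℂ) • f, (y : L)⁆, _⟩).mpr (hIJ (hIn hf) y.2)
  let a : I := ⟨_, he⟩
  let b : I := ⟨_, hf⟩
  -- The cocycle condition is an exact identity in `L`: by Jacobi, `⁅e, ⁅h, f⁆⁆ = ⁅f, ⁅h, e⁆⁆` when
  -- `h = ⁅e, f⁆`.
  have hab : LieModule.toEnd ℂ L (I ⧸ W) e (LieSubmodule.Quotient.mk b) =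
      LieModule.toEnd ℂ L (I ⧸ W) f (LieSubmodule.Quotient.mk a) := by
    refine (hmk' ⁅e, b⁆ ⁅f, a⁆).mpr ?_
    have : ⁅e, ⁅h, f⁆ + (2 : ℂ) • f⁆ - ⁅f, ⁅h, e⁆ - (2 : ℂ) • e⁆ = 0 := by
      have h1 : ⁅e, ⁅h, f⁆⁆ = ⁅f, ⁅h, e⁆⁆ := by
        rw [leibniz_lie e h f, hh, lie_self, add_zero, ← lie_skew, ← lie_skew e h, lie_neg, neg_neg]
      rw [lie_add, lie_sub, lie_smul, lie_smul, ← lie_skew f e, hh, h1, smul_neg]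
      abel
    change ⁅e, ⁅h, f⁆ + (2 : ℂ) • f⁆ - ⁅f, ⁅h, e⁆ - (2 : ℂ) • e⁆ ∈ J
    rw [this]
    exact zero_mem _
  obtain ⟨u, v, hu, hv⟩ := r.exists_correction hab
  obtain ⟨y, rfl⟩ := hsurj u
  obtain ⟨z, rfl⟩ := hsurj v
  have hY : (⁅h, e⁆ - (2 : ℂ) • e) + ⁅h, (y : L)⁆ + ⁅e, ⁅f, (y : L)⁆⁆ - ⁅e, ⁅e, (z : L)⁆⁆ -
      (2 : ℂ) • (y : L) ∈ J := (hmk' (a + ⁅h, y⁆ + ⁅e, ⁅f, y⁆⁆ - ⁅e, ⁅e, z⁆⁆) ((2 : ℂ) • y)).mp hu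
  have hZ : (⁅h, f⁆ + (2 : ℂ) • f) + ⁅h, (z : L)⁆ - ⁅f, ⁅e, (z : L)⁆⁆ + ⁅f, ⁅f, (y : L)⁆⁆ -
      -((2 : ℂ) • (z : L)) ∈ J :=
    (hmk' (b + ⁅h, z⁆ - ⁅f, ⁅e, z⁆⁆ + ⁅f, ⁅f, y⁆⁆) (-((2 : ℂ) • z))).mp hv
  have hII : ∀ {x y : L}, x ∈ I → y ∈ I → ⁅x, y⁆ ∈ J := fun hx hy => hIJ (hIn hx) hy
  have yz : ⁅(y : L), (z : L)⁆ ∈ J := hII y.2 z.2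
  refine ⟨y, y.2, z, z.2, ?_, ?_⟩
  · have : ⁅⁅e + y, f + z⁆, e + y⁆ - (2 : ℂ) • (e + (y : L)) =
      ((⁅h, e⁆ - (2 : ℂ) • e) + ⁅h, (y : L)⁆ + ⁅e, ⁅f, (y : L)⁆⁆ - ⁅e, ⁅e, (z : L)⁆⁆ -
      (2 : ℂ) • (y : L)) + (⁅⁅e, (z : L)⁆, (y : L)⁆ + ⁅⁅(y : L), f⁆, (y : L)⁆ -
        ⁅e, ⁅(y : L), (z : L)⁆⁆ + ⁅⁅(y : L), (z : L)⁆, (y : L)⁆) := by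
      rw [← lie_skew e ⁅(y : L), (z : L)⁆, ← lie_skew e ⁅f, (y : L)⁆, ← lie_skew f (y : L),
        ← lie_skew e ⁅e, (z : L)⁆]
      simp only [lie_add, add_lie, hh, smul_add, neg_lie]
      abel
    rw [this]
    exact add_mem hY (add_mem (sub_mem (add_mem (hII (lie_mem_right _ _ _ _ _ z.2) y.2)
      (hII (lie_mem_left _ _ _ _ _ y.2) y.2)) (lie_mem_right _ _ _ _ _ yz))
      (lie_mem_left _ _ _ _ _ yz))
  · have : ⁅⁅e + y, f + z⁆, f + z⁆ + (2 : ℂ) • (f + (z : L)) =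
      ((⁅h, f⁆ + (2 : ℂ) • f) + ⁅h, (z : L)⁆ - ⁅f, ⁅e, (z : L)⁆⁆ + ⁅f, ⁅f, (y : L)⁆⁆ -
      -((2 : ℂ) • (z : L))) + (⁅⁅e, (z : L)⁆, (z : L)⁆ + ⁅⁅(y : L), f⁆, (z : L)⁆ -
        ⁅f, ⁅(y : L), (z : L)⁆⁆ + ⁅⁅(y : L), (z : L)⁆, (z : L)⁆) := by
      rw [← lie_skew f ⁅(y : L), (z : L)⁆, ← lie_skew f ⁅f, (y : L)⁆, ← lie_skew f (y : L),
        ← lie_skew f ⁅e, (z : L)⁆]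
      simp only [lie_add, add_lie, hh, smul_add, neg_lie]
      abel
    rw [this]
    exact add_mem hZ (add_mem (sub_mem (add_mem (hII (lie_mem_right _ _ _ _ _ z.2) z.2)
      (hII (lie_mem_left _ _ _ _ _ y.2) z.2)) (lie_mem_right _ _ _ _ _ yz))
      (lie_mem_left _ _ _ _ _ yz))

/-- An `𝔰𝔩₂`-triple modulo a nilpotent ideal lifts to an `𝔰𝔩₂`-triple. -/
theorem exists_sl2_lift {n : LieIdeal ℂ L} {D : ℕ → LieIdeal ℂ L} (h0 : D 0 = n)
    (hD : ∀ k, D (k + 1) ≤ D k) (hnD : ∀ k, ⁅n, D k⁆ ≤ D (k + 1)) {m : ℕ} (hm : D m = ⊥)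
    {e f h : L} (hh : ⁅e, f⁆ - h ∈ n) (he : ⁅h, e⁆ - (2 : ℂ) • e ∈ n)
    (hf : ⁅h, f⁆ + (2 : ℂ) • f ∈ n) :
    ∃ e' f' h' : L, e' - e ∈ n ∧ f' - f ∈ n ∧ h' - h ∈ n ∧ ⁅e', f'⁆ = h' ∧
      ⁅h', e'⁆ = (2 : ℂ) • e' ∧ ⁅h', f'⁆ = -((2 : ℂ) • f') := by
  have hle : ∀ k, D k ≤ n := fun k => h0 ▸ antitone_nat_of_succ_le hD (Nat.zero_le k)
  -- The given `h` is replaced by `⁅e', f'⁆`; each correction then moves the two errors one step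
  -- down the filtration.
  have key : ∀ k, ∃ e' f' : L, e' - e ∈ n ∧ f' - f ∈ n ∧ ⁅⁅e', f'⁆, e'⁆ - (2 : ℂ) • e' ∈ D k ∧
      ⁅⁅e', f'⁆, f'⁆ + (2 : ℂ) • f' ∈ D k := by
    intro k
    induction k with
    | zero =>
      refine ⟨e, f, by simp, by simp, ?_, ?_⟩
      · rw [h0]
        have := add_mem (lie_mem_left ℂ L n _ e hh) he
        rwa [sub_lie, ← add_sub_assoc, sub_add_cancel] at this
      · rw [h0]
        have := add_mem (lie_mem_left ℂ L n _ f hh) hf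
        rwa [sub_lie, ← add_assoc, sub_add_cancel] at this
    | succ k ih =>
      obtain ⟨e', f', hee, hff, h1, h2⟩ := ih
      obtain ⟨y, hy, z, hz, h3, h4⟩ := exists_sl2_lift_succ (hle k) (hnD k) rfl h1 h2
      refine ⟨e' + y, f' + z, ?_, ?_, h3, h4⟩
      · rw [add_sub_right_comm]
        exact add_mem hee (hle k hy)
      · rw [add_sub_right_comm]
        exact add_mem hff (hle k hz)
  obtain ⟨e', f', hee, hff, h1, h2⟩ := key m
  rw [hm, LieSubmodule.mem_bot] at h1 h2
  refine ⟨e', f', ⁅e', f'⁆, hee, hff, ?_, rfl, sub_eq_zero.mp h1, eq_neg_of_add_eq_zero_left h2⟩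
  have : ⁅e', f'⁆ - h = ⁅e' - e, f'⁆ + ⁅e, f' - f⁆ + (⁅e, f⁆ - h) := by
    rw [sub_lie, lie_sub]
    abel
  rw [this]
  exact add_mem (add_mem (lie_mem_left ℂ L n _ _ hee) (lie_mem_right ℂ L n _ _ hff)) hh

end Lift

/-! ### Central extensions of semisimple Lie algebras -/

section CentralExtension

variable {C L : Type*} [LieRing C] [LieAlgebra ℂ C] [LieRing L] [LieAlgebra ℂ L]
  [FiniteDimensional ℂ L]

/-- A central element of the derived algebra is killed by every functional if the quotient by the
centre has a nondegenerate Killing form. -/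
theorem eq_zero_of_mem_derived_of_map_eq_zero [IsKilling ℂ L] {p : C →ₗ⁅ℂ⁆ L}
    (hp : Function.Surjective p) (hker : ∀ z, p z = 0 → ∀ y : C, ⁅z, y⁆ = 0) {z : C}
    (hz : z ∈ derivedSeries ℂ C 1) (hpz : p z = 0) : z = 0 := by
  rw [← Module.forall_dual_apply_eq_zero_iff ℂ z]
  intro φ
  obtain ⟨σ, hσ⟩ := (p : C →ₗ[ℂ] L).exists_rightInverse_of_surjective (LinearMap.range_eq_top.mpr hp)
  replace hσ : ∀ a, p (σ a) = a := fun a => LinearMap.congr_fun hσ a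
  have hlie : ∀ x x' y : C, p x = p x' → ⁅x, y⁆ = ⁅x', y⁆ := fun x x' y h => by
    rw [← sub_eq_zero, ← sub_lie]
    exact hker _ (by rw [map_sub, h, sub_self]) _
  have hσσ : ∀ x y : C, ⁅σ (p x), σ (p y)⁆ = ⁅x, y⁆ := fun x y => by
    rw [hlie _ x _ (hσ _), ← lie_skew, hlie _ y _ (hσ _), lie_skew]
  -- The 2-cocycle of the extension, evaluated by `φ`. As the kernel is central, it does not depend
  -- on the section `σ`.
  let ω : L →ₗ[ℂ] Module.Dual ℂ L := LinearMap.mk₂ ℂ (fun a b => φ ⁅σ a, σ b⁆)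
    (fun a b c => by simp) (fun c a b => by simp) (fun a b c => by simp) (fun c a b => by simp)
  let κ := (killingForm ℂ L).toDual (IsKilling.killingForm_nondegenerate ℂ L)
  have hκ : ∀ a b, killingForm ℂ L (κ.symm (ω a)) b = φ ⁅σ a, σ b⁆ := fun a b =>
    LinearMap.BilinForm.apply_toDual_symm_apply (ω a) b
  have hinv : ∀ a b c, killingForm ℂ L ⁅a, b⁆ c = killingForm ℂ L a ⁅b, c⁆ :=
    LieModule.traceForm_apply_lie_apply ℂ L L
  have hbr : ∀ a b c, φ ⁅σ ⁅a, b⁆, σ c⁆ = φ ⁅⁅σ a, σ b⁆, σ c⁆ := fun a b c => by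
    rw [hlie (σ ⁅a, b⁆) ⁅σ a, σ b⁆ _ (by rw [hσ, LieHom.map_lie, hσ, hσ])]
  -- Through the Killing form the cocycle identity becomes the Leibniz rule. The derivation is
  -- inner, so the cocycle is a coboundary and `φ` factors through `p` on the derived algebra.
  let D : LieDerivation ℂ L L :=
    { toLinearMap := κ.symm.toLinearMap ∘ₗ ω
      leibniz' := fun a b => by
        change κ.symm (ω ⁅a, b⁆) = ⁅a, κ.symm (ω b)⁆ - ⁅b, κ.symm (ω a)⁆
        rw [← sub_eq_zero]
        refine (IsKilling.killingForm_nondegenerate ℂ L).1 _ fun c => ?_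
        have h1 : ∀ a b, killingForm ℂ L ⁅a, κ.symm (ω b)⁆ c = φ ⁅⁅σ a, σ c⁆, σ b⁆ := by
          intro a b
          rw [← lie_skew, map_neg, LinearMap.neg_apply, hinv, hκ, ← map_neg, lie_skew, hbr]
        rw [map_sub, map_sub, LinearMap.sub_apply, LinearMap.sub_apply, h1, h1, hκ, hbr,
          ← map_sub, ← map_sub, lie_lie (σ a), ← lie_skew ⁅σ a, σ c⁆, ← lie_skew ⁅σ b, σ c⁆]
        rw [show ⁅σ a, ⁅σ b, σ c⁆⁆ - ⁅σ b, ⁅σ a, σ c⁆⁆ -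
          (-⁅σ b, ⁅σ a, σ c⁆⁆ - -⁅σ a, ⁅σ b, σ c⁆⁆) = 0 by abel, map_zero] }
  obtain ⟨u, hu⟩ := LieDerivation.IsKilling.exists_eq_ad D
  have hφ : ∀ x y : C, φ ⁅x, y⁆ = killingForm ℂ L u (p ⁅x, y⁆) := by
    intro x y
    have h1 : κ.symm (ω (p x)) = ⁅u, p x⁆ := by
      have := LieDerivation.congr_fun hu (p x)
      rw [LieDerivation.ad_apply_apply] at this
      exact this.symm
    rw [← hσσ x y, ← hκ, h1, hinv, LieHom.map_lie, hσ, hσ]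
  have key : ∀ w ∈ derivedSeries ℂ C 1, φ w = killingForm ℂ L u (p w) := by
    intro w hw
    rw [derivedSeries_def, derivedSeriesOfIdeal_succ, derivedSeriesOfIdeal_zero,
      ← LieSubmodule.mem_toSubmodule, LieSubmodule.lieIdeal_oper_eq_linear_span'] at hw
    induction hw using Submodule.span_induction with
    | mem w hw => obtain ⟨x, -, y, -, rfl⟩ := hw; exact hφ x y
    | zero => simp
    | add a b _ _ ha hb => simp only [map_add, ha, hb]
    | smul c a _ ha => simp only [map_smul, ha]
  rw [key z hz, hpz, map_zero]

/-- The Killing complement of `[L, L]` is abelian, since its brackets lie in it and in `[L, L]`;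
hence it is zero. -/
theorem derivedSeries_one_eq_top [IsKilling ℂ L] : derivedSeries ℂ L 1 = ⊤ := by
  have hc := LieIdeal.isCompl_killingCompl (derivedSeries ℂ L 1)
  have : IsLieAbelian (LieIdeal.killingCompl ℂ L (derivedSeries ℂ L 1)) := by
    rw [LieSubmodule.lie_abelian_iff_lie_self_eq_bot, eq_bot_iff, ← hc.inf_eq_bot]
    refine le_inf ?_ (LieSubmodule.lie_le_left _ _)
    rw [derivedSeries_def, derivedSeriesOfIdeal_succ, derivedSeriesOfIdeal_zero]
    exact LieSubmodule.mono_lie le_top le_top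
  have h2 := hc.sup_eq_top
  rwa [IsKilling.ideal_eq_bot_of_isLieAbelian (LieIdeal.killingCompl ℂ L (derivedSeries ℂ L 1)),
    sup_bot_eq] at h2

theorem exists_mem_derived_map_eq [IsKilling ℂ L] {p : C →ₗ⁅ℂ⁆ L}
    (hp : Function.Surjective p) (a : L) : ∃ s ∈ derivedSeries ℂ C 1, p s = a := by
  have h1 : a ∈ (derivedSeries ℂ C 1).map p := by
    rw [LieIdeal.derivedSeries_map_eq 1 hp, derivedSeries_one_eq_top]
    exact LieSubmodule.mem_top a
  obtain ⟨s, hs⟩ := LieIdeal.mem_map_of_surjective hp h1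
  exact ⟨s, s.2, hs⟩

end CentralExtension

/-! ### Splitting off a semisimple ideal -/

section Splitting

variable {g : Type*} [LieRing g] [LieAlgebra ℂ g]

theorem lie_mem_bracket {L : Type*} [LieRing L] [LieAlgebra ℂ L] (I : LieIdeal ℂ L) {x y : L}
    (hx : x ∈ I) (hy : y ∈ I) : ⁅x, y⁆ ∈ ⁅I, I⁆ := LieSubmodule.lie_mem_lie hx hy

theorem isNilpotent_of_lie_lie_eq_zero {L : Type*} [LieRing L] [LieAlgebra ℂ L]
    (h : ∀ x y z : L, ⁅x, ⁅y, z⁆⁆ = 0) : LieRing.IsNilpotent L := by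
  refine (LieModule.isNilpotent_iff ℂ L L).mpr ⟨2, ?_⟩
  rw [LieModule.lowerCentralSeries_succ, LieSubmodule.lie_eq_bot_iff]
  intro x _ m hm
  rw [LieModule.lowerCentralSeries_succ, LieModule.lowerCentralSeries_zero,
    ← LieSubmodule.mem_toSubmodule, LieSubmodule.lieIdeal_oper_eq_linear_span'] at hm
  induction hm using Submodule.span_induction with
  | mem w hw => obtain ⟨y, -, z, -, rfl⟩ := hw; exact h x y z
  | zero => exact lie_zero x
  | add a b _ _ ha hb => rw [lie_add, ha, hb, add_zero]
  | smul c a _ ha => rw [lie_smul, ha, smul_zero]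

/-- Climb the derived series of `Q`: if its next term lies in `n`, the present one, which
centralizes `n`, has vanishing triple brackets and so is a nilpotent ideal. -/
theorem le_of_isSolvable_of_le_ker {n : LieIdeal ℂ g}
    (hn : ∀ I : LieIdeal ℂ g, LieRing.IsNilpotent I → I ≤ n) {Q : LieIdeal ℂ g} [IsSolvable Q]
    (hQ : Q ≤ LieModule.ker ℂ g n) : Q ≤ n := by
  obtain ⟨k, hk⟩ := IsSolvable.solvable ℂ Q
  rw [LieIdeal.derivedSeries_eq_bot_iff] at hk
  have key : ∀ j, derivedSeriesOfIdeal ℂ g j Q ≤ n → Q ≤ n := by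
    intro j
    induction j with
    | zero => exact id
    | succ j ih =>
      intro hj
      refine ih (hn _ (isNilpotent_of_lie_lie_eq_zero fun x y z => Subtype.ext ?_))
      have hx := hQ (derivedSeriesOfIdeal_le_self Q j x.2)
      rw [derivedSeriesOfIdeal_succ] at hj
      have hyz : ⁅(y : g), (z : g)⁆ ∈ n := hj (lie_mem_bracket _ y.2 z.2)
      have hxyz := congrArg Subtype.val ((LieModule.mem_ker ℂ g n (x : g)).mp hx ⟨_, hyz⟩)
      exact hxyz
  exact key k (hk ▸ bot_le)

/-- The operator `ad z` maps into `n`, which `ad x` kills. -/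
theorem killingForm_eq_zero_of_mem_ker {n : LieIdeal ℂ g} {x z : g}
    (hx : x ∈ LieModule.ker ℂ g n) (hz : z ∈ n) : killingForm ℂ g x z = 0 := by
  have : ad ℂ g x ∘ₗ ad ℂ g z = 0 := by
    ext y
    exact congrArg Subtype.val ((LieModule.mem_ker ℂ g n x).mp hx ⟨_, lie_mem_left ℂ g n _ y hz⟩)
  rw [killingForm_apply_apply, this, map_zero]

variable [FiniteDimensional ℂ g]

/-- The radical of the Killing form restricted to the centralizer of `n` is a solvable ideal by
Cartan's criterion. -/
theorem mem_of_killingForm_eq_zero {n : LieIdeal ℂ g}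
    (hn : ∀ I : LieIdeal ℂ g, LieRing.IsNilpotent I → I ≤ n) {x : g}
    (hx : x ∈ LieModule.ker ℂ g n)
    (hκ : ∀ y ∈ LieModule.ker ℂ g n, killingForm ℂ g y x = 0) : x ∈ n := by
  let Q : LieIdeal ℂ g := LieModule.ker ℂ g n ⊓ (LieModule.ker ℂ g n).killingCompl
  have : IsSolvable Q := LieIdeal.isSolvable_of_killingForm_apply_lie_eq_zero Q
    fun a ha b hb => (LieSubmodule.lie_le_left Q Q hb).2 a ha.1
  exact le_of_isSolvable_of_le_ker hn (inf_le_left : Q ≤ _) ⟨hx, hκ⟩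

/-- The quotient of the centralizer of `n` by its intersection with `n` has a nondegenerate Killing
form. -/
theorem isKilling_of_map_eq_zero_iff {n : LieIdeal ℂ g}
    (hn : ∀ I : LieIdeal ℂ g, LieRing.IsNilpotent I → I ≤ n)
    {L : Type*} [LieRing L] [LieAlgebra ℂ L] [FiniteDimensional ℂ L]
    {p : LieModule.ker ℂ g n →ₗ⁅ℂ⁆ L} (hp : Function.Surjective p)
    (hker : ∀ x, p x = 0 ↔ (x : g) ∈ n) : IsKilling ℂ L := by
  have : HasTrivialRadical ℂ L := by
    rw [hasTrivialRadical_iff_no_abelian_ideals]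
    intro I hI
    rw [eq_bot_iff]
    intro a ha
    obtain ⟨x, rfl⟩ := hp a
    rw [LieSubmodule.mem_bot, hker]
    refine mem_of_killingForm_eq_zero hn x.2 fun y hy => ?_
    rw [LieModule.traceForm_comm, killingForm_apply_apply]
    -- Exponent 3: successive applications of `y, x, y, x, y` lead into `C`, `p⁻¹ I`, `p⁻¹ I`, `n`
    -- (as `I` is abelian) and finally 0.
    refine (LinearMap.isNilpotent_trace_of_isNilpotent ⟨3, ?_⟩).eq_zero
    have h1 : ∀ w : g, ⁅y, w⁆ ∈ LieModule.ker ℂ g n := fun w => lie_mem_left ℂ g _ _ _ hy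
    have h2 : ∀ w (hw : w ∈ LieModule.ker ℂ g n), p ⟨⁅(x : g), w⁆, lie_mem_right ℂ g _ _ _ hw⟩ ∈ I := by
      intro w hw
      have := lie_mem_left ℂ L I (p x) (p ⟨w, hw⟩) ha
      rwa [← LieHom.map_lie] at this
    have h3 : ∀ w (hw : w ∈ LieModule.ker ℂ g n), p ⟨w, hw⟩ ∈ I →
        p ⟨⁅y, w⁆, lie_mem_right ℂ g _ _ _ hw⟩ ∈ I := by
      intro w hw hwI
      have := lie_mem_right ℂ L I (p ⟨y, hy⟩) (p ⟨w, hw⟩) hwI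
      rwa [← LieHom.map_lie] at this
    have h4 : ∀ w (hw : w ∈ LieModule.ker ℂ g n), p ⟨w, hw⟩ ∈ I → ⁅(x : g), w⁆ ∈ n := by
      intro w hw hwI
      have h5 : ⁅(⟨p x, ha⟩ : I), (⟨p ⟨w, hw⟩, hwI⟩ : I)⁆ = 0 := trivial_lie_zero _ _ _ _
      have h6 : ⁅p x, p ⟨w, hw⟩⁆ = 0 := congrArg Subtype.val h5
      rw [← LieHom.map_lie] at h6
      exact (hker _).mp h6
    ext w
    have h7 := h4 _ (lie_mem_right ℂ g _ y _ (lie_mem_right ℂ g _ (x : g) _ (h1 w)))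
      (h3 _ _ (h2 _ (h1 w)))
    have h8 := congrArg Subtype.val ((LieModule.mem_ker ℂ g n y).mp hy ⟨_, h7⟩)
    change ⁅(x : g), ⁅y, ⁅(x : g), ⁅y, ⁅(x : g), ⁅y, w⁆⁆⁆⁆⁆⁆ = 0
    change ⁅y, ⁅(x : g), ⁅y, ⁅(x : g), ⁅y, w⁆⁆⁆⁆⁆ = 0 at h8
    rw [h8, lie_zero]
  infer_instance

/-- The quotient map of a Lie algebra by an ideal as a homomorphism of Lie algebras. -/
def quotientMk {L : Type*} [LieRing L] [LieAlgebra ℂ L] (I : LieIdeal ℂ L) : L →ₗ⁅ℂ⁆ L ⧸ I :=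
  { (LieSubmodule.Quotient.mk' I : L →ₗ[ℂ] L ⧸ I) with
    map_lie' := fun {x y} => LieSubmodule.Quotient.mk_bracket I x y }

/-- The Killing form of an ideal is the restriction of the one of `g`, so `S` meets its orthogonal
trivially. -/
theorem isCompl_killingCompl_of_isKilling (S : LieIdeal ℂ g) [IsKilling ℂ S] :
    IsCompl S S.killingCompl := by
  rw [← LieSubmodule.isCompl_toSubmodule, LieIdeal.toSubmodule_killingCompl,
    LinearMap.BilinForm.isCompl_orthogonal_iff_disjoint (LieModule.traceForm_isSymm ℂ g g).isRefl,
    Submodule.disjoint_def]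
  intro x hx hxo
  have : (⟨x, hx⟩ : S) = 0 := by
    refine (IsKilling.killingForm_nondegenerate ℂ S).1 _ fun y => ?_
    have h1 : killingForm ℂ S ⟨x, hx⟩ y = killingForm ℂ g x y := by
      rw [LieIdeal.killingForm_eq]
      rfl
    rw [h1, LieModule.traceForm_comm]
    exact hxo y y.2
  exact congrArg Subtype.val this

/-- A Lie algebra is the direct sum of a semisimple ideal and an ideal that contains the nilradical
and in which the nilradical contains its centralizer. -/
theorem exists_isCompl_of_forall_isNilpotent_le {n : LieIdeal ℂ g}
    (hn : ∀ I : LieIdeal ℂ g, LieRing.IsNilpotent I → I ≤ n) :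
    ∃ S H : LieIdeal ℂ g, IsCompl S H ∧ LieAlgebra.IsSemisimple ℂ S ∧ n ≤ H ∧
      ∀ x ∈ H, (∀ y ∈ n, ⁅x, y⁆ = 0) → x ∈ n := by
  let C : LieIdeal ℂ g := LieModule.ker ℂ g n
  let Z : LieIdeal ℂ C := n.comap C.incl
  have hp : Function.Surjective (quotientMk Z) := LieSubmodule.Quotient.surjective_mk' Z
  have hker : ∀ x : C, quotientMk Z x = 0 ↔ (x : g) ∈ n := fun x =>
    LieSubmodule.Quotient.mk_eq_zero Z
  have hK : IsKilling ℂ (C ⧸ Z) := isKilling_of_map_eq_zero_iff hn hp hker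
  have hcen : ∀ z, quotientMk Z z = 0 → ∀ y : C, ⁅z, y⁆ = 0 := by
    intro z hz y
    have h1 := congrArg Subtype.val ((LieModule.mem_ker ℂ g n (y : g)).mp y.2 ⟨_, (hker z).mp hz⟩)
    rw [← lie_skew, neg_eq_zero]
    exact Subtype.ext h1
  let S : LieIdeal ℂ g := ⁅C, C⁆
  have hSC : S ≤ C := LieSubmodule.lie_le_left C C
  have hS : ∀ s : C, s ∈ derivedSeries ℂ C 1 ↔ (s : g) ∈ S := by
    intro s
    rw [LieIdeal.derivedSeries_eq_derivedSeriesOfIdeal_comap, LieIdeal.mem_comap,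
      derivedSeriesOfIdeal_succ, derivedSeriesOfIdeal_zero]
    rfl
  let q : S →ₗ⁅ℂ⁆ C ⧸ Z := (quotientMk Z).comp (LieIdeal.inclusion hSC)
  have hqi : Function.Injective q := by
    rw [injective_iff_map_eq_zero]
    intro s hs
    have := eq_zero_of_mem_derived_of_map_eq_zero hp hcen ((hS ⟨s, hSC s.2⟩).mpr s.2) hs
    exact Subtype.ext (congrArg (fun c : C => (c : g)) this)
  have hqs : Function.Surjective q := by
    intro a
    obtain ⟨s, hs, rfl⟩ := exists_mem_derived_map_eq hp a
    exact ⟨⟨s, (hS s).mp hs⟩, rfl⟩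
  have hSK : IsKilling ℂ S := isKilling_of_equiv (LieEquiv.ofBijective q ⟨hqi, hqs⟩).symm
  refine ⟨S, S.killingCompl, isCompl_killingCompl_of_isKilling S, inferInstance, ?_, ?_⟩
  · intro z hz
    exact S.mem_killingCompl.mpr fun s hs => killingForm_eq_zero_of_mem_ker (hSC hs) hz
  · intro x hx hxn
    have hxC : x ∈ C := (LieModule.mem_ker ℂ g n x).mpr fun m => Subtype.ext (hxn m m.2)
    refine mem_of_killingForm_eq_zero hn hxC fun y hy => ?_
    -- Every `y` in `C` is an element of `S` plus one of `n`, and `x` is Killing-orthogonal to both.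
    obtain ⟨s, hs⟩ := hqs (quotientMk Z ⟨y, hy⟩)
    have hz : y - s ∈ n := by
      rw [← hker ⟨y - s, sub_mem hy (hSC s.2)⟩]
      change quotientMk Z (⟨y, hy⟩ - ⟨s, hSC s.2⟩) = 0
      rw [map_sub, ← hs]
      exact sub_self _
    have h1 := S.mem_killingCompl.mp hx s s.2
    have h2 := killingForm_eq_zero_of_mem_ker hxC hz
    rw [LieModule.traceForm_comm, map_sub, LinearMap.sub_apply, h1, sub_zero] at h2
    exact h2

end Splitting

/-! ### The free nilpotent algebra: lower central series, abelianization, grading -/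

theorem lowerCentralSeries_induction {L : Type*} [LieRing L] [LieAlgebra ℂ L]
    {P : ℕ → L → Prop} (base : ∀ x, P 0 x) (zero : ∀ k, P k 0)
    (add : ∀ k x y, P k x → P k y → P k (x + y)) (smul : ∀ k (c : ℂ) x, P k x → P k (c • x))
    (lie : ∀ (k : ℕ) (x y : L), y ∈ LieModule.lowerCentralSeries ℂ L L k → P k y → P (k + 1) ⁅x, y⁆) (k : ℕ) :
    ∀ x ∈ LieModule.lowerCentralSeries ℂ L L k, P k x := by
  induction k with
  | zero => exact fun x _ => base x
  | succ k ih =>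
    intro x hx
    rw [LieModule.lowerCentralSeries_succ, ← LieSubmodule.mem_toSubmodule,
      LieSubmodule.lieIdeal_oper_eq_linear_span'] at hx
    induction hx using Submodule.span_induction with
    | mem w hw => obtain ⟨a, -, b, hb, rfl⟩ := hw; exact lie k a b hb (ih b hb)
    | zero => exact zero _
    | add a b _ _ ha hb => exact add _ a b ha hb
    | smul c a _ ha => exact smul _ c a ha

/-- The lower central series of `𝔫_{2,t}`. -/
abbrev lcs (t k : ℕ) : LieIdeal ℂ (N t) := LieModule.lowerCentralSeries ℂ (N t) (N t) k

section FreeNilpotent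

variable {t : ℕ}

theorem lie_mem_lcs_succ {k : ℕ} (a : N t) {b : N t} (hb : b ∈ lcs t k) : ⁅a, b⁆ ∈ lcs t (k + 1) := by
  rw [lcs, LieModule.lowerCentralSeries_succ]
  exact LieSubmodule.lie_mem_lie (LieSubmodule.mem_top a) hb

theorem lcs_antitone : Antitone (lcs t) := LieModule.antitone_lowerCentralSeries ℂ (N t) (N t)

/-- Numbering from 0, `lcs t 1` consists of brackets of length at least 2, so bracketing with it
gains two steps, by Jacobi. -/
theorem lie_mem_lcs_of_mem_lcs_one {k : ℕ} {a b : N t} (ha : a ∈ lcs t k) (hb : b ∈ lcs t 1) :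
    ⁅a, b⁆ ∈ lcs t (k + 2) := by
  rw [lcs, LieModule.lowerCentralSeries_succ, ← LieSubmodule.mem_toSubmodule,
      LieSubmodule.lieIdeal_oper_eq_linear_span'] at hb
  induction hb using Submodule.span_induction with
  | mem w hw =>
    obtain ⟨p, -, q, -, rfl⟩ := hw
    have hr : ∀ {j : ℕ} {x : N t} (y : N t), x ∈ lcs t j → ⁅x, y⁆ ∈ lcs t (j + 1) :=
      fun y hx => by
        rw [← lie_skew]
        exact neg_mem (lie_mem_lcs_succ _ hx)
    rw [leibniz_lie]
    exact add_mem (hr _ (hr _ ha)) (lie_mem_lcs_succ _ (hr _ ha))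
  | zero => rw [lie_zero]; exact zero_mem _
  | add a b _ _ ha hb => rw [lie_add]; exact add_mem ha hb
  | smul c a _ ha => rw [lie_smul]; exact SMulMemClass.smul_mem c ha

theorem der_mem_lcs (D : Der t) (k : ℕ) : ∀ a ∈ lcs t k, D a ∈ lcs t k := by
  refine lowerCentralSeries_induction (P := fun k a => D a ∈ lcs t k) (fun a => by simp)
    (fun k => by simp) (fun k a b ha hb => by rw [map_add]; exact add_mem ha hb)
    (fun k c a ha => by rw [map_smul]; exact SMulMemClass.smul_mem c ha) (fun k a b hb hDb => ?_) k
  rw [LieDerivation.apply_lie_eq_sub, ← lie_skew b, sub_neg_eq_add]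
  exact add_mem (lie_mem_lcs_succ _ hDb) (lie_mem_lcs_succ _ hb)

theorem der_mem_lcs_succ (D : Der t) (hD : ∀ a, D a ∈ lcs t 1) (k : ℕ) :
    ∀ a ∈ lcs t k, D a ∈ lcs t (k + 1) := by
  refine lowerCentralSeries_induction (P := fun k a => D a ∈ lcs t (k + 1)) hD
    (fun k => by simp) (fun k a b ha hb => by rw [map_add]; exact add_mem ha hb)
    (fun k c a ha => by rw [map_smul]; exact SMulMemClass.smul_mem c ha) (fun k a b hb hDb => ?_) k
  rw [LieDerivation.apply_lie_eq_sub]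
  exact sub_mem (lie_mem_lcs_succ _ hDb) (lie_mem_lcs_of_mem_lcs_one hb (hD a))

theorem lieSubalgebra_eq_top {S : LieSubalgebra ℂ (N t)} (h : ∀ i, gen t i ∈ S) (a : N t) :
    a ∈ S := by
  let φ : FL →ₗ⁅ℂ⁆ S := FreeLieAlgebra.lift ℂ (fun i => (⟨gen t i, h i⟩ : S))
  have hφ : S.incl.comp φ = mkN t := by
    apply FreeLieAlgebra.hom_ext
    intro i
    rw [LieHom.comp_apply, FreeLieAlgebra.lift_of_apply]
    rfl
  obtain ⟨u, rfl⟩ := mkN_surjective t a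
  rw [← hφ]
  exact (φ u).2

/-- The plane `ℂ²` as an abelian Lie algebra. -/
def Plane : Type := Fin 2 → ℂ

instance : AddCommGroup Plane := inferInstanceAs (AddCommGroup (Fin 2 → ℂ))

instance : Module ℂ Plane := inferInstanceAs (Module ℂ (Fin 2 → ℂ))

instance : LieRing Plane where
  bracket _ _ := 0
  add_lie _ _ _ := (add_zero 0).symm
  lie_add _ _ _ := (add_zero 0).symm
  lie_self _ := rfl
  leibniz_lie _ _ _ := (add_zero 0).symm

instance : LieAlgebra ℂ Plane where
  lie_smul c _ _ := (smul_zero c).symm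

/-- The standard basis of the plane. -/
def planeBasis (i : Fin 2) : Plane := (Pi.single i 1 : Fin 2 → ℂ)

/-- The abelianization of the free Lie algebra. -/
def planeLift : FL →ₗ⁅ℂ⁆ Plane :=
  FreeLieAlgebra.lift ℂ planeBasis

theorem planeLift_eq_zero (ht : 1 ≤ t) :
    (FLpow t).toSubmodule ≤ LinearMap.ker (planeLift : FL →ₗ[ℂ] Plane) := by
  intro u hu
  have h1 : u ∈ LieModule.lowerCentralSeries ℂ FL FL 1 :=
    LieModule.antitone_lowerCentralSeries ℂ FL FL ht hu
  rw [LieModule.lowerCentralSeries_succ, ← LieSubmodule.mem_toSubmodule,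
      LieSubmodule.lieIdeal_oper_eq_linear_span'] at h1
  refine Submodule.span_le.mpr ?_ h1
  rintro _ ⟨a, -, b, -, rfl⟩
  exact LieHom.map_lie planeLift a b

/-- The projection of `𝔫_{2,t}` to its abelianization. -/
def proj (ht : 1 ≤ t) : N t →ₗ[ℂ] Fin 2 → ℂ :=
  (FLpow t).toSubmodule.liftQ (planeLift : FL →ₗ[ℂ] Plane) (planeLift_eq_zero ht)

theorem proj_gen (ht : 1 ≤ t) (i : Fin 2) : proj ht (gen t i) = Pi.single i 1 :=
  (FreeLieAlgebra.lift_of_apply (R := ℂ) planeBasis i :)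

theorem proj_lie (ht : 1 ≤ t) (a b : N t) : proj ht ⁅a, b⁆ = 0 := by
  obtain ⟨a, rfl⟩ := mkN_surjective t a
  obtain ⟨b, rfl⟩ := mkN_surjective t b
  rw [← LieHom.map_lie]
  exact LieHom.map_lie planeLift a b

/-- The linear section of `proj` with image `𝔪`. -/
def sect (t : ℕ) : (Fin 2 → ℂ) →ₗ[ℂ] N t := Fintype.linearCombination ℂ (gen t)

theorem sect_apply (v : Fin 2 → ℂ) : sect t v = v 0 • gen t 0 + v 1 • gen t 1 := by
  simp [sect, Fintype.linearCombination_apply]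

theorem sub_sect_proj_mem (ht : 1 ≤ t) (a : N t) : a - sect t (proj ht a) ∈ lcs t 1 := by
  let S : LieSubalgebra ℂ (N t) :=
    { (lcs t 1).toSubmodule.comap (LinearMap.id - sect t ∘ₗ proj ht) with
      lie_mem' := fun {a b} _ _ => by
        change ⁅a, b⁆ - sect t (proj ht ⁅a, b⁆) ∈ lcs t 1
        rw [proj_lie, map_zero, sub_zero]
        exact lie_mem_lcs_succ _ (by simp) }
  refine lieSubalgebra_eq_top (S := S) (fun i => ?_) a
  change gen t i - sect t (proj ht (gen t i)) ∈ lcs t 1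
  rw [proj_gen, sect_apply]
  fin_cases i <;> simp

theorem proj_eq_zero_of_mem (ht : 1 ≤ t) {a : N t} (ha : a ∈ lcs t 1) : proj ht a = 0 := by
  rw [lcs, LieModule.lowerCentralSeries_succ, ← LieSubmodule.mem_toSubmodule,
      LieSubmodule.lieIdeal_oper_eq_linear_span'] at ha
  refine (Submodule.span_le (p := LinearMap.ker (proj ht))).mpr ?_ ha
  rintro _ ⟨a, -, b, -, rfl⟩
  exact proj_lie ht a b

theorem mem_lcs_one_iff (ht : 1 ≤ t) {a : N t} : a ∈ lcs t 1 ↔ proj ht a = 0 := by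
  refine ⟨proj_eq_zero_of_mem ht, fun h => ?_⟩
  have := sub_sect_proj_mem ht a
  rwa [h, map_zero, sub_zero] at this

/-- The matrix of the map induced by a derivation on the abelianization. -/
def symbol (ht : 1 ≤ t) : Der t →ₗ[ℂ] Matrix (Fin 2) (Fin 2) ℂ where
  toFun D := Matrix.of fun i j => proj ht (D (gen t j)) i
  map_add' D E := by ext i j; simp
  map_smul' c D := by ext i j; simp

theorem symbol_apply (ht : 1 ≤ t) (D : Der t) (i j : Fin 2) :
    symbol ht D i j = proj ht (D (gen t j)) i := rfl

/-- A derivation preserves `lcs t 1`, so only the part of `a` in `𝔪` matters. -/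
theorem proj_der (ht : 1 ≤ t) (D : Der t) (a : N t) :
    proj ht (D a) = (symbol ht D).mulVec (proj ht a) := by
  have h1 : D a = D (sect t (proj ht a)) + D (a - sect t (proj ht a)) := by
    rw [← map_add, add_sub_cancel]
  have h2 := proj_eq_zero_of_mem ht (der_mem_lcs D 1 _ (sub_sect_proj_mem ht a))
  rw [h1, map_add, h2, add_zero, sect_apply]
  ext i
  simp [Matrix.mulVec, dotProduct, symbol_apply]
  ring

theorem symbol_lie (ht : 1 ≤ t) (D E : Der t) :
    symbol ht ⁅D, E⁆ = symbol ht D * symbol ht E - symbol ht E * symbol ht D := by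
  ext i j
  have h : ∀ D E : Der t, proj ht (D (E (gen t j))) i = (symbol ht D * symbol ht E) i j :=
    fun D E => by
      rw [proj_der]
      rfl
  rw [symbol_apply, LieDerivation.lie_apply, map_sub, Pi.sub_apply, h, h]
  rfl

theorem symbol_eq_zero_iff (ht : 1 ≤ t) (D : Der t) : symbol ht D = 0 ↔ ∀ a, D a ∈ lcs t 1 := by
  constructor
  · intro h a
    rw [mem_lcs_one_iff ht, proj_der, h, Matrix.zero_mulVec]
  · intro h
    ext i j
    rw [symbol_apply, proj_eq_zero_of_mem ht (h _)]
    rfl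

theorem sect_proj_of_mem_homog (ht : 1 ≤ t) {a : N t} (ha : a ∈ homog t 1) :
    sect t (proj ht a) = a := by
  rw [homog_one] at ha
  refine (Submodule.span_le
    (p := LinearMap.eqLocus (sect t ∘ₗ proj ht) LinearMap.id)).mpr ?_ ha
  rintro _ ⟨i, rfl⟩
  change sect t (proj ht (gen t i)) = gen t i
  rw [proj_gen, sect_apply]
  fin_cases i <;> simp

theorem mem_derOne_iff (ht : 1 ≤ t) {D : Der t} :
    D ∈ derOne t ↔ ∀ j, D (gen t j) = symbol ht D 0 j • gen t 0 + symbol ht D 1 j • gen t 1 := by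
  constructor
  · intro hD j
    rw [← sect_proj_of_mem_homog ht (hD _ (gen_mem t j)), sect_apply]
    rfl
  · intro h a ha
    rw [homog_one] at ha
    refine (Submodule.span_le
      (p := (homog t 1).comap (D : N t →ₗ[ℂ] N t))).mpr ?_ ha
    rintro _ ⟨j, rfl⟩
    change D (gen t j) ∈ homog t 1
    rw [h j]
    exact add_mem (Submodule.smul_mem _ _ (gen_mem t 0)) (Submodule.smul_mem _ _ (gen_mem t 1))

theorem lie_mem_derOneZero {D E : Der t} (hD : D ∈ derOne t) (hE : E ∈ derOne t) :
    ⁅D, E⁆ ∈ derOneZero t :=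
  ⟨⁅(⟨D, hD⟩ : derOne t), (⟨E, hE⟩ : derOne t)⁆,
    LieSubmodule.lie_mem_lie (LieSubmodule.mem_top _) (LieSubmodule.mem_top _), rfl⟩

theorem trace_symbol_of_mem_derOneZero (ht : 1 ≤ t) {D : Der t} (hD : D ∈ derOneZero t) :
    (symbol ht D).trace = 0 := by
  obtain ⟨D, hD, rfl⟩ := hD
  have h1 : D ∈ (⁅(⊤ : LieIdeal ℂ (derOne t)), (⊤ : LieIdeal ℂ (derOne t))⁆ : LieIdeal _ _) := hD
  rw [← LieSubmodule.mem_toSubmodule, LieSubmodule.lieIdeal_oper_eq_linear_span'] at h1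
  refine (Submodule.span_le (p := LinearMap.ker (Matrix.traceLinearMap (Fin 2) ℂ ℂ ∘ₗ symbol ht ∘ₗ
    ((derOne t).incl : derOne t →ₗ[ℂ] Der t)))).mpr ?_ h1
  rintro _ ⟨a, -, b, -, rfl⟩
  change (symbol ht ⁅(a : Der t), (b : Der t)⁆).trace = 0
  rw [symbol_lie, Matrix.trace_sub, Matrix.trace_mul_comm, sub_self]

theorem homog_lie_gen {k : ℕ} {a : N t} (ha : a ∈ homog t k) (j : Fin 2) :
    ⁅a, gen t j⁆ ∈ homog t (k + 1) := by
  rw [← lie_skew]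
  refine (Submodule.span_le (p := (homog t (k + 1)).comap
    (-(LieAlgebra.ad ℂ (N t) (gen t j))))).mpr ?_ ha
  rintro _ ⟨i, l, hl, rfl⟩
  change -⁅gen t j, l.foldl (fun b j => ⁅b, gen t j⁆) (gen t i)⁆ ∈ homog t (k + 1)
  rw [lie_skew]
  refine Submodule.subset_span ⟨i, l ++ [j], by simp [← hl], ?_⟩
  rw [List.foldl_append]
  rfl

theorem homog_le_lcs (k : ℕ) : homog t (k + 1) ≤ (lcs t k).toSubmodule := by
  refine Submodule.span_le.mpr ?_
  rintro _ ⟨i, l, hl, rfl⟩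
  have key : ∀ (l : List (Fin 2)) (a : N t) (m : ℕ), a ∈ lcs t m →
      l.foldl (fun b j => ⁅b, gen t j⁆) a ∈ lcs t (m + l.length) := by
    intro l
    induction l with
    | nil => intro a m ha; exact ha
    | cons j l ih =>
      intro a m ha
      have h1 : ⁅a, gen t j⁆ ∈ lcs t (m + 1) := by
        rw [← lie_skew]
        exact neg_mem (lie_mem_lcs_succ _ ha)
      have := ih _ (m + 1) h1
      rw [List.foldl_cons, List.length_cons]
      rwa [show m + (l.length + 1) = m + 1 + l.length by omega]
  have := key l (gen t i) 0 (by simp)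
  rwa [zero_add, show l.length = k by omega] at this

/-- The span of the left-normed brackets of length at least `m`. -/
def homogFrom (t m : ℕ) : Submodule ℂ (N t) := ⨆ k ≥ m, homog t k

theorem homog_le_homogFrom {m k : ℕ} (h : m ≤ k) : homog t k ≤ homogFrom t m :=
  le_iSup₂_of_le k h le_rfl

theorem homogFrom_antitone : Antitone (homogFrom t) := fun _ _ h =>
  iSup₂_le fun _ hk => homog_le_homogFrom (h.trans hk)

/-- By Jacobi the elements `b` with this property form a subalgebra, and it contains the generators.
-/
theorem lie_mem_homogFrom (b : N t) : ∀ (m : ℕ), ∀ a ∈ homogFrom t m, ⁅a, b⁆ ∈ homogFrom t (m + 1) := by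
  let S : LieSubalgebra ℂ (N t) :=
    { carrier := {b | ∀ (m : ℕ), ∀ a ∈ homogFrom t m, ⁅a, b⁆ ∈ homogFrom t (m + 1)}
      add_mem' := fun hb hc m a ha => by
        rw [lie_add]
        exact add_mem (hb m a ha) (hc m a ha)
      zero_mem' := fun m a _ => by
        rw [lie_zero]
        exact zero_mem _
      smul_mem' := fun c _ hb m a ha => by
        rw [lie_smul]
        exact Submodule.smul_mem _ c (hb m a ha)
      lie_mem' := fun {b c} hb hc m a ha => by
        rw [leibniz_lie, ← lie_skew b]
        exact homogFrom_antitone (Nat.le_succ (m + 1)) (add_mem (hc _ _ (hb _ _ ha))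
          (neg_mem (hb _ _ (hc _ _ ha)))) }
  refine lieSubalgebra_eq_top (S := S) (fun j m a ha => ?_) b
  have h1 : homogFrom t m ≤ (homogFrom t (m + 1)).comap (-(LieAlgebra.ad ℂ (N t) (gen t j))) := by
    refine iSup₂_le fun k hk a ha => ?_
    change -⁅gen t j, a⁆ ∈ homogFrom t (m + 1)
    rw [lie_skew]
    exact homog_le_homogFrom (Nat.succ_le_succ hk) (homog_lie_gen ha j)
  rw [← lie_skew]
  exact h1 ha

theorem mem_homogFrom_one (a : N t) : a ∈ homogFrom t 1 := by
  let S : LieSubalgebra ℂ (N t) :=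
    { homogFrom t 1 with
      lie_mem' := fun {a b} ha _ => homogFrom_antitone (Nat.le_succ 1) (lie_mem_homogFrom b 1 a ha) }
  exact lieSubalgebra_eq_top (S := S) (fun i => homog_le_homogFrom le_rfl (gen_mem t i)) a

/-- Left-normed brackets of length at least 2 span the derived algebra, and those longer than `t`
vanish. -/
theorem lcs_one_le_iSup_homog : (lcs t 1).toSubmodule ≤ ⨆ j ∈ Finset.Icc 2 t, homog t j := by
  have h1 : (lcs t 1).toSubmodule ≤ homogFrom t 2 := by
    rw [lcs, LieModule.lowerCentralSeries_succ, LieSubmodule.lieIdeal_oper_eq_linear_span',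
      Submodule.span_le]
    rintro _ ⟨a, -, b, -, rfl⟩
    exact lie_mem_homogFrom b 1 a (mem_homogFrom_one a)
  refine h1.trans (iSup₂_le fun k hk => ?_)
  by_cases hkt : k ≤ t
  · exact le_iSup₂_of_le k (Finset.mem_Icc.mpr ⟨hk, hkt⟩) le_rfl
  · obtain ⟨j, rfl⟩ : ∃ j, k = j + 1 := ⟨k - 1, by omega⟩
    refine (homog_le_lcs j).trans ?_
    have h2 : lcs t j ≤ ⊥ := (lowerCentralSeries_eq_bot t) ▸ lcs_antitone (by omega : t ≤ j)
    exact le_trans (show (lcs t j).toSubmodule ≤ ⊥ from h2) bot_le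

/-- The derivation that sends one generator to a given element and the other one to zero. -/
def singleDer (t : ℕ) (i : Fin 2) : N t →ₗ[ℂ] Der t where
  toFun v := extendDer t (Pi.single i v)
  map_add' v w := der_ext fun j => by
    simp only [LieDerivation.add_apply, extendDer_gen, Pi.single_add, Pi.add_apply]
  map_smul' c v := der_ext fun j => by
    simp only [LieDerivation.smul_apply, extendDer_gen, Pi.single_smul, Pi.smul_apply,
      RingHom.id_apply]

theorem singleDer_gen (i : Fin 2) (v : N t) (j : Fin 2) :
    singleDer t i v (gen t j) = (Pi.single i v : Fin 2 → N t) j :=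
  extendDer_gen t _ j

theorem singleDer_mem (i : Fin 2) {k : ℕ} {v : N t} (hv : v ∈ homog t k) :
    singleDer t i v ∈ derHomog t k := by
  intro a ha
  rw [homog_one] at ha
  refine (Submodule.span_le
    (p := (homog t k).comap (singleDer t i v : N t →ₗ[ℂ] N t))).mpr ?_ ha
  rintro _ ⟨j, rfl⟩
  change singleDer t i v (gen t j) ∈ homog t k
  rw [singleDer_gen]
  by_cases hij : j = i
  · subst hij
    rwa [Pi.single_eq_same]
  · rw [Pi.single_eq_of_ne hij]
    exact zero_mem _

/-- The derivation is determined by its two values on the generators; each is a sum of components in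
`𝔪^j` with `2 ≤ j ≤ t`, and each component extends to a derivation in `Der_j`. -/
theorem mem_nilDer {D : Der t} (hD : ∀ a, D a ∈ lcs t 1) : D ∈ nilDer t := by
  have h1 : D = singleDer t 0 (D (gen t 0)) + singleDer t 1 (D (gen t 1)) :=
    der_ext fun j => by
      rw [LieDerivation.add_apply, singleDer_gen, singleDer_gen]
      fin_cases j <;> simp
  have h2 : ∀ i, (⨆ j ∈ Finset.Icc 2 t, homog t j) ≤ (nilDer t).comap (singleDer t i) := by
    refine fun i => iSup₂_le fun k hk v hv => ?_
    exact (le_iSup₂_of_le k hk le_rfl : derHomog t k ≤ nilDer t) (singleDer_mem i hv)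
  rw [h1]
  exact add_mem (h2 0 (lcs_one_le_iSup_homog (hD _))) (h2 1 (lcs_one_le_iSup_homog (hD _)))

end FreeNilpotent

/-! ### The action on the nilradical and its kernel modulo the derived algebra -/

section Action

variable {t : ℕ} {H : Type*} [LieRing H] [LieAlgebra ℂ H] {n : LieIdeal ℂ H}

/-- The adjoint action of a Lie algebra on an ideal identified with `𝔫_{2,t}`. -/
def act (φ : n ≃ₗ⁅ℂ⁆ N t) : H →ₗ⁅ℂ⁆ Der t where
  toFun x :=
    { toFun := fun a => φ ⁅x, φ.symm a⁆
      map_add' := fun a b => by rw [map_add, lie_add, map_add]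
      map_smul' := fun c a => by rw [map_smul, lie_smul, map_smul, RingHom.id_apply]
      leibniz' := fun a b => by
        change φ ⁅x, φ.symm ⁅a, b⁆⁆ = ⁅a, φ ⁅x, φ.symm b⁆⁆ - ⁅b, φ ⁅x, φ.symm a⁆⁆
        have h1 : ⁅x, ⁅φ.symm a, φ.symm b⁆⁆ =
            ⁅φ.symm a, ⁅x, φ.symm b⁆⁆ - ⁅φ.symm b, ⁅x, φ.symm a⁆⁆ := by
          apply Subtype.ext
          change ⁅x, ⁅(φ.symm a : H), (φ.symm b : H)⁆⁆ =
            ⁅(φ.symm a : H), ⁅x, (φ.symm b : H)⁆⁆ - ⁅(φ.symm b : H), ⁅x, (φ.symm a : H)⁆⁆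
          rw [leibniz_lie, ← lie_skew (φ.symm b : H)]
          abel
        rw [LieEquiv.map_lie, h1, map_sub, LieEquiv.map_lie, LieEquiv.map_lie,
          LieEquiv.apply_symm_apply, LieEquiv.apply_symm_apply] }
  map_add' x y := by
    ext a
    change φ ⁅x + y, φ.symm a⁆ = φ ⁅x, φ.symm a⁆ + φ ⁅y, φ.symm a⁆
    rw [add_lie, map_add]
  map_smul' c x := by
    ext a
    change φ ⁅c • x, φ.symm a⁆ = c • φ ⁅x, φ.symm a⁆
    rw [smul_lie, map_smul]
  map_lie' {x y} := by
    ext a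
    rw [LieDerivation.lie_apply]
    change φ ⁅⁅x, y⁆, φ.symm a⁆ =
      φ ⁅x, φ.symm (φ ⁅y, φ.symm a⁆)⁆ - φ ⁅y, φ.symm (φ ⁅x, φ.symm a⁆)⁆
    rw [LieEquiv.symm_apply_apply, LieEquiv.symm_apply_apply, lie_lie, map_sub]

variable (φ : n ≃ₗ⁅ℂ⁆ N t)

theorem act_apply (x : H) (a : N t) : act φ x a = φ ⁅x, φ.symm a⁆ := rfl

theorem act_map (x : H) (y : n) : act φ x (φ y) = φ ⁅x, y⁆ := by
  rw [act_apply, LieEquiv.symm_apply_apply]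

theorem lie_symm_apply (x : H) (a : N t) : ⁅x, (φ.symm a : H)⁆ = φ.symm (act φ x a) := by
  rw [act_apply, LieEquiv.symm_apply_apply]
  rfl

theorem act_coe (x : n) (a : N t) : act φ x a = ⁅φ x, a⁆ := by
  rw [act_apply]
  have : ⁅(x : H), φ.symm a⁆ = ⁅x, φ.symm a⁆ := rfl
  rw [this, LieEquiv.map_lie, LieEquiv.apply_symm_apply]

/-- The elements that act trivially on the abelianization of `𝔫_{2,t}`. -/
def unipotentIdeal : LieIdeal ℂ H where
  carrier := {x | ∀ a, act φ x a ∈ lcs t 1}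
  add_mem' hx hy a := by
    rw [map_add]
    exact add_mem (hx a) (hy a)
  zero_mem' a := by
    rw [map_zero]
    exact zero_mem _
  smul_mem' c x hx a := by
    rw [map_smul]
    exact SMulMemClass.smul_mem c (hx a)
  lie_mem {x y} hy a := by
    rw [LieHom.map_lie, LieDerivation.lie_apply]
    exact sub_mem (der_mem_lcs _ _ _ (hy a)) (hy _)

theorem act_mem_lcs_of_mem_lowerCentralSeries (j : ℕ) :
    ∀ x ∈ LieModule.lowerCentralSeries ℂ (unipotentIdeal φ) (unipotentIdeal φ) j,
      ∀ i, ∀ a ∈ lcs t i, act φ x a ∈ lcs t (i + j + 1) := by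
  refine lowerCentralSeries_induction
    (P := fun j (x : unipotentIdeal φ) => ∀ i, ∀ a ∈ lcs t i, act φ x a ∈ lcs t (i + j + 1))
    (fun x => der_mem_lcs_succ _ x.2) (fun k i a _ => ?_) (fun k x y hx hy i a ha => ?_)
    (fun k c x hx i a ha => ?_) (fun k x y _ hy i a ha => ?_) j
  · change act φ (0 : H) a ∈ _
    rw [map_zero]
    exact zero_mem _
  · change act φ ((x : H) + (y : H)) a ∈ _
    rw [map_add]
    exact add_mem (hx i a ha) (hy i a ha)
  · change act φ (c • (x : H)) a ∈ _
    rw [map_smul]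
    exact SMulMemClass.smul_mem c (hx i a ha)
  · change act φ ⁅(x : H), (y : H)⁆ a ∈ _
    rw [LieHom.map_lie, LieDerivation.lie_apply]
    refine sub_mem (der_mem_lcs_succ _ x.2 _ _ (hy i a ha)) ?_
    have := hy (i + 1) _ (der_mem_lcs_succ _ x.2 _ _ ha)
    rwa [show i + 1 + k + 1 = i + (k + 1) + 1 by omega] at this

/-- Each bracket raises by one the shift on the lower central series of `n`. After `t` steps the
action is zero, so the terms lie in `n` by `hcen`; `t` further steps descend through `n` itself. -/
theorem isNilpotent_unipotentIdeal (hcen : ∀ x : H, (∀ y ∈ n, ⁅x, y⁆ = 0) → x ∈ n) :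
    LieRing.IsNilpotent (unipotentIdeal φ) := by
  have h1 : ∀ x ∈ LieModule.lowerCentralSeries ℂ (unipotentIdeal φ) (unipotentIdeal φ) t,
      (x : H) ∈ n := by
    refine fun x hx => hcen _ fun y hy => ?_
    have h2 := act_mem_lcs_of_mem_lowerCentralSeries φ t x hx 0 (φ ⟨y, hy⟩) (by simp)
    have h3 : act φ x (φ ⟨y, hy⟩) ∈ lcs t t := lcs_antitone (by omega) h2
    rw [lcs, lowerCentralSeries_eq_bot, LieSubmodule.mem_bot, act_map, ← map_zero φ] at h3
    exact congrArg Subtype.val (φ.injective h3)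
  have key : ∀ k, ∀ x ∈ LieModule.lowerCentralSeries ℂ (unipotentIdeal φ) (unipotentIdeal φ) (t + k),
      ∃ hx : (x : H) ∈ n, φ ⟨x, hx⟩ ∈ lcs t k := by
    intro k
    induction k with
    | zero => exact fun x hx => ⟨h1 x hx, by simp⟩
    | succ k ih =>
      intro x hx
      rw [← add_assoc, LieModule.lowerCentralSeries_succ, ← LieSubmodule.mem_toSubmodule,
        LieSubmodule.lieIdeal_oper_eq_linear_span'] at hx
      induction hx using Submodule.span_induction with
      | mem w hw =>
        obtain ⟨y, -, z, hz, rfl⟩ := hw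
        obtain ⟨hzn, hz'⟩ := ih z hz
        refine ⟨lie_mem_right ℂ H n _ _ hzn, ?_⟩
        have := der_mem_lcs_succ _ y.2 _ _ hz'
        rwa [act_map] at this
      | zero => exact ⟨zero_mem _, by
        have h : φ 0 ∈ lcs t k.succ := by
          rw [map_zero]
          exact zero_mem _
        exact h⟩
      | add a b _ _ ha hb =>
        obtain ⟨ha, ha'⟩ := ha
        obtain ⟨hb, hb'⟩ := hb
        refine ⟨add_mem ha hb, ?_⟩
        have := add_mem ha' hb'
        rwa [← map_add] at this
      | smul c a _ ha =>
        obtain ⟨ha, ha'⟩ := ha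
        refine ⟨SMulMemClass.smul_mem c ha, ?_⟩
        have := SMulMemClass.smul_mem c ha'
        rwa [← map_smul] at this
  refine (LieModule.isNilpotent_iff ℂ _ _).mpr ⟨t + t, (LieSubmodule.eq_bot_iff _).mpr fun x hx => ?_⟩
  obtain ⟨hxn, h2⟩ := key t x hx
  rw [lcs, lowerCentralSeries_eq_bot, LieSubmodule.mem_bot, ← map_zero φ] at h2
  exact Subtype.ext (congrArg (fun y : n => (y : H)) (φ.injective h2))

/-- The matrix by which an element acts on the abelianization of `𝔫_{2,t}`. -/
def actMatrix (ht : 1 ≤ t) : H →ₗ[ℂ] Matrix (Fin 2) (Fin 2) ℂ :=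
  symbol ht ∘ₗ (act φ : H →ₗ[ℂ] Der t)

theorem actMatrix_apply (ht : 1 ≤ t) (x : H) : actMatrix φ ht x = symbol ht (act φ x) := rfl

theorem actMatrix_lie (ht : 1 ≤ t) (x y : H) : actMatrix φ ht ⁅x, y⁆ =
    actMatrix φ ht x * actMatrix φ ht y - actMatrix φ ht y * actMatrix φ ht x := by
  rw [actMatrix_apply, LieHom.map_lie, symbol_lie]
  rfl

theorem actMatrix_eq_zero_of_mem (ht : 1 ≤ t) {x : H} (hx : x ∈ n) : actMatrix φ ht x = 0 := by
  rw [actMatrix_apply, symbol_eq_zero_iff]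
  intro a
  rw [act_coe φ ⟨x, hx⟩]
  exact lie_mem_lcs_succ _ (by simp)

theorem actMatrix_eq_zero_iff (ht : 1 ≤ t) (hcen : ∀ x : H, (∀ y ∈ n, ⁅x, y⁆ = 0) → x ∈ n)
    (hn : ∀ I : LieIdeal ℂ H, LieRing.IsNilpotent I → I ≤ n) {x : H} :
    actMatrix φ ht x = 0 ↔ x ∈ n := by
  refine ⟨fun h => hn _ (isNilpotent_unipotentIdeal φ hcen) ?_, actMatrix_eq_zero_of_mem φ ht⟩
  exact (symbol_eq_zero_iff ht _).mp h

/-- The lower central series of an ideal identified with `𝔫_{2,t}`, as ideals of the whole Lie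
algebra. -/
def lcsIdeal (k : ℕ) : LieIdeal ℂ H where
  carrier := {x | ∃ hx : x ∈ n, φ ⟨x, hx⟩ ∈ lcs t k}
  add_mem' := fun ⟨ha, ha'⟩ ⟨hb, hb'⟩ => ⟨add_mem ha hb, by
    have := add_mem ha' hb'
    rwa [← map_add] at this⟩
  zero_mem' := ⟨zero_mem _, by
    have h : φ 0 ∈ lcs t k := by
      rw [map_zero]
      exact zero_mem _
    exact h⟩
  smul_mem' := fun c _ ⟨ha, ha'⟩ => ⟨SMulMemClass.smul_mem c ha, by
    have := SMulMemClass.smul_mem c ha'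
    rwa [← map_smul] at this⟩
  lie_mem := fun {x _} ⟨ha, ha'⟩ => ⟨lie_mem_right ℂ H n _ _ ha, by
    have := der_mem_lcs (act φ x) _ _ ha'
    rwa [act_map] at this⟩

theorem lcsIdeal_zero : lcsIdeal φ 0 = n := by
  ext x
  exact ⟨fun h => h.1, fun h => ⟨h, by simp⟩⟩

theorem lcsIdeal_succ_le (k : ℕ) : lcsIdeal φ (k + 1) ≤ lcsIdeal φ k :=
  fun _ hx => ⟨hx.1, lcs_antitone (Nat.le_succ k) hx.2⟩

theorem lie_lcsIdeal_le (k : ℕ) : ⁅n, lcsIdeal φ k⁆ ≤ lcsIdeal φ (k + 1) := by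
  rw [LieSubmodule.lieIdeal_oper_eq_span, LieSubmodule.lieSpan_le]
  rintro _ ⟨x, ⟨y, hy, hy'⟩, rfl⟩
  refine ⟨lie_mem_right ℂ H n _ _ hy, ?_⟩
  have := lie_mem_lcs_succ (φ x) hy'
  rwa [← LieEquiv.map_lie] at this

theorem lcsIdeal_eq_bot : lcsIdeal φ t = ⊥ := by
  refine (LieSubmodule.eq_bot_iff _).mpr ?_
  rintro x ⟨hxn, h2⟩
  rw [lcs, lowerCentralSeries_eq_bot, LieSubmodule.mem_bot, ← map_zero φ] at h2
  exact congrArg (fun y : n => (y : H)) (φ.injective h2)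

end Action

/-! ### Lie algebras of 2 × 2 matrices -/

section Solvable

theorem derivedSeriesOfIdeal_induction {L : Type*} [LieRing L] [LieAlgebra ℂ L] (k : ℕ)
    (P : Submodule ℂ L)
    (h : ∀ x ∈ derivedSeries ℂ L k, ∀ y ∈ derivedSeries ℂ L k, ⁅x, y⁆ ∈ P) :
    ∀ x ∈ derivedSeries ℂ L (k + 1), x ∈ P := by
  intro x hx
  rw [derivedSeries_def, derivedSeriesOfIdeal_succ, ← LieSubmodule.mem_toSubmodule,
    LieSubmodule.lieIdeal_oper_eq_linear_span'] at hx
  refine Submodule.span_le.mpr ?_ hx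
  rintro _ ⟨a, ha, b, hb, rfl⟩
  exact h a ha b hb

theorem exists_span_pair_of_finrank_le_two {V : Type*} [AddCommGroup V] [Module ℂ V]
    [FiniteDimensional ℂ V] {W : Submodule ℂ V} (hW : Module.finrank ℂ W ≤ 2) :
    ∃ v w : V, ∀ x ∈ W, ∃ a b : ℂ, x = a • v + b • w := by
  let b := Module.finBasis ℂ W
  let f : Fin 2 → V := fun i => if h : (i : ℕ) < Module.finrank ℂ W then b ⟨i, h⟩ else 0
  refine ⟨f 0, f 1, fun x hx => ?_⟩
  have h1 : x ∈ Submodule.span ℂ (Set.range f) := by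
    have h2 : x = ∑ i, b.repr ⟨x, hx⟩ i • (b i : V) := by
      have := congrArg Subtype.val (b.sum_repr ⟨x, hx⟩)
      simpa [-Module.Basis.sum_repr] using this.symm
    rw [h2]
    refine Submodule.sum_mem _ fun i _ => Submodule.smul_mem _ _ (Submodule.subset_span ?_)
    exact ⟨⟨i, i.2.trans_le hW⟩, by simp [f]⟩
  rw [Submodule.mem_span_range_iff_exists_fun] at h1
  obtain ⟨c, hc⟩ := h1
  exact ⟨c 0, c 1, by rw [← hc, Fin.sum_univ_two]⟩

/-- A Lie algebra of `2 × 2` matrices either contains all matrices of trace zero or is solvable. -/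
theorem exists_map_eq_of_not_isSolvable {L : Type*} [LieRing L] [LieAlgebra ℂ L]
    [FiniteDimensional ℂ L]
    {A : L →ₗ[ℂ] Matrix (Fin 2) (Fin 2) ℂ} (hA : ∀ x y, A ⁅x, y⁆ = A x * A y - A y * A x)
    {n : LieIdeal ℂ L} [IsSolvable n] (hker : ∀ x, A x = 0 → x ∈ n) (hL : ¬ IsSolvable L)
    {M : Matrix (Fin 2) (Fin 2) ℂ} (hM : M.trace = 0) : ∃ x, A x = M := by
  let S : Submodule ℂ (Matrix (Fin 2) (Fin 2) ℂ) := LinearMap.ker (Matrix.traceLinearMap (Fin 2) ℂ ℂ)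
  let W : Submodule ℂ (Matrix (Fin 2) (Fin 2) ℂ) := (derivedSeries ℂ L 1).toSubmodule.map A
  have hWS : W ≤ S := by
    rintro _ ⟨x, hx, rfl⟩
    refine derivedSeriesOfIdeal_induction 0 (S.comap A) (fun x _ y _ => ?_) x hx
    change (A ⁅x, y⁆).trace = 0
    rw [hA, Matrix.trace_sub, Matrix.trace_mul_comm, sub_self]
  have hS : Module.finrank ℂ S ≤ 3 := by
    have h1 : S ≠ ⊤ := by
      intro h
      have : (1 : Matrix (Fin 2) (Fin 2) ℂ) ∈ S := h ▸ Submodule.mem_top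
      have h2 : (1 : Matrix (Fin 2) (Fin 2) ℂ).trace = 0 := this
      simp at h2
    have h2 := Submodule.finrank_lt h1
    rw [Module.finrank_matrix] at h2
    simp at h2
    omega
  by_cases hW : Module.finrank ℂ W ≤ 2
  · exfalso
    apply hL
    obtain ⟨v, w, hvw⟩ := exists_span_pair_of_finrank_le_two hW
    -- If `v, w` span the image of the first derived algebra, all commutators there are multiples of
    -- one matrix; the third derived algebra then acts by zero and lies in `n`.
    have h2 : ∀ x ∈ derivedSeries ℂ L 2, A x ∈ Submodule.span ℂ {v * w - w * v} := by
      refine derivedSeriesOfIdeal_induction 1 ((Submodule.span ℂ {v * w - w * v}).comap A)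
        fun x hx y hy => ?_
      rw [Submodule.mem_comap, hA]
      obtain ⟨a, b, hab⟩ := hvw (A x) ⟨x, hx, rfl⟩
      obtain ⟨c, d, hcd⟩ := hvw (A y) ⟨y, hy, rfl⟩
      refine Submodule.mem_span_singleton.mpr ⟨a * d - b * c, ?_⟩
      rw [hab, hcd]
      simp only [mul_add, add_mul, smul_mul_assoc, mul_smul_comm]
      module
    have h3 : derivedSeries ℂ L 3 ≤ n := by
      refine fun x hx => hker x (derivedSeriesOfIdeal_induction 2 (LinearMap.ker A)
        (fun x hx y hy => ?_) x hx)
      rw [LinearMap.mem_ker, hA]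
      obtain ⟨a, ha⟩ := Submodule.mem_span_singleton.mp (h2 x hx)
      obtain ⟨b, hb⟩ := Submodule.mem_span_singleton.mp (h2 y hy)
      rw [← ha, ← hb]
      simp only [smul_mul_assoc, mul_smul_comm]
      rw [smul_comm, sub_self]
    obtain ⟨k, hk⟩ := IsSolvable.solvable ℂ n
    rw [LieIdeal.derivedSeries_eq_bot_iff] at hk
    refine IsSolvable.mk (R := ℂ) (k := k + 3) ?_
    rw [derivedSeries_def, derivedSeriesOfIdeal_add, eq_bot_iff, ← hk]
    exact derivedSeriesOfIdeal_mono h3 k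
  · have hWS' : W = S := Submodule.eq_of_le_of_finrank_le hWS (by omega)
    have : M ∈ W := hWS' ▸ (show M ∈ S from hM)
    obtain ⟨x, -, hx⟩ := this
    exact ⟨x, hx⟩

end Solvable

/-! ### Automorphisms given by a change of generators -/

section Automorphism

variable {t : ℕ}

theorem lift_eq_zero (T : Fin 2 → N t) :
    (FLpow t).toSubmodule ≤ LinearMap.ker (FreeLieAlgebra.lift ℂ T : FL →ₗ[ℂ] N t) := by
  intro u hu
  have h1 : FreeLieAlgebra.lift ℂ T u ∈ lcs t t :=
    LieIdeal.map_lowerCentralSeries_le t (LieIdeal.mem_map hu)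
  rwa [lcs, lowerCentralSeries_eq_bot] at h1

/-- The endomorphism of `𝔫_{2,t}` with prescribed values on the generators. -/
def genHom (T : Fin 2 → N t) : N t →ₗ⁅ℂ⁆ N t :=
  { (FLpow t).toSubmodule.liftQ (FreeLieAlgebra.lift ℂ T : FL →ₗ[ℂ] N t) (lift_eq_zero T) with
    map_lie' := fun {a b} => by
      obtain ⟨a, rfl⟩ := mkN_surjective t a
      obtain ⟨b, rfl⟩ := mkN_surjective t b
      rw [← LieHom.map_lie]
      exact LieHom.map_lie (FreeLieAlgebra.lift ℂ T) a b }

theorem genHom_gen (T : Fin 2 → N t) (i : Fin 2) : genHom T (gen t i) = T i :=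
  (FreeLieAlgebra.lift_of_apply (R := ℂ) T i :)

theorem genHom_mem_lcs (T : Fin 2 → N t) (k : ℕ) : ∀ a ∈ lcs t k, genHom T a ∈ lcs t k :=
  fun _ ha => LieIdeal.map_lowerCentralSeries_le k (LieIdeal.mem_map ha)

theorem genHom_sub_mem (T : Fin 2 → N t) (hT : ∀ i, T i - gen t i ∈ lcs t 1) (k : ℕ) :
    ∀ a ∈ lcs t k, genHom T a - a ∈ lcs t (k + 1) := by
  have h1 : ∀ a, genHom T a - a ∈ lcs t 1 := by
    let S : LieSubalgebra ℂ (N t) :=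
      { (lcs t 1).toSubmodule.comap ((genHom T : N t →ₗ[ℂ] N t) - LinearMap.id) with
        lie_mem' := fun {a b} _ _ => by
          change genHom T ⁅a, b⁆ - ⁅a, b⁆ ∈ lcs t 1
          rw [LieHom.map_lie]
          exact sub_mem (lie_mem_lcs_succ _ (by simp)) (lie_mem_lcs_succ _ (by simp)) }
    refine lieSubalgebra_eq_top (S := S) fun i => ?_
    change genHom T (gen t i) - gen t i ∈ lcs t 1
    rw [genHom_gen]
    exact hT i
  refine lowerCentralSeries_induction (P := fun k a => genHom T a - a ∈ lcs t (k + 1)) h1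
    (fun k => by simp) (fun k a b ha hb => ?_) (fun k c a ha => ?_) (fun k a b hb hTb => ?_) k
  · rw [map_add, add_sub_add_comm]
    exact add_mem ha hb
  · rw [map_smul, ← smul_sub]
    exact SMulMemClass.smul_mem c ha
  · have : genHom T ⁅a, b⁆ - ⁅a, b⁆ =
        -⁅genHom T b, genHom T a - a⁆ + ⁅a, genHom T b - b⁆ := by
      rw [LieHom.map_lie, lie_skew, sub_lie, lie_sub]
      abel
    rw [this]
    exact add_mem (neg_mem (lie_mem_lcs_of_mem_lcs_one (genHom_mem_lcs T k b hb) (h1 a)))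
      (lie_mem_lcs_succ _ hTb)

/-- The map differs from the identity by one that raises the filtration, so an element of its kernel
lies in every `lcs t k`. -/
theorem genHom_injective (T : Fin 2 → N t) (hT : ∀ i, T i - gen t i ∈ lcs t 1) :
    Function.Injective (genHom T) := by
  rw [injective_iff_map_eq_zero]
  intro a ha
  have key : ∀ k, a ∈ lcs t k := by
    intro k
    induction k with
    | zero => simp
    | succ k ih =>
      have := neg_mem (genHom_sub_mem T hT k a ih)
      rwa [ha, zero_sub, neg_neg] at this
  have := key t
  rwa [lcs, lowerCentralSeries_eq_bot, LieSubmodule.mem_bot] at this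

/-- The automorphism of `𝔫_{2,t}` with prescribed values on the generators. -/
def genEquiv [FiniteDimensional ℂ (N t)] (T : Fin 2 → N t) (hT : ∀ i, T i - gen t i ∈ lcs t 1) :
    N t ≃ₗ⁅ℂ⁆ N t :=
  LieEquiv.ofBijective (genHom T) ⟨genHom_injective T hT,
    (LinearMap.injective_iff_surjective (f := (genHom T : N t →ₗ[ℂ] N t))).mp
      (genHom_injective T hT)⟩

theorem genEquiv_gen [FiniteDimensional ℂ (N t)] (T : Fin 2 → N t)
    (hT : ∀ i, T i - gen t i ∈ lcs t 1) (i : Fin 2) : genEquiv T hT (gen t i) = T i :=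
  genHom_gen T i

end Automorphism

/-! ### Generators adapted to an `𝔰𝔩₂`-triple -/

section StandardTriple

variable {t : ℕ} {H : Type*} [LieRing H] [LieAlgebra ℂ H] {n : LieIdeal ℂ H}

/-- An `𝔰𝔩₂`-triple that acts on the generators of `𝔫_{2,t}` by the standard matrices. -/
structure IsStandardTriple (φ : n ≃ₗ⁅ℂ⁆ N t) (e f h : H) : Prop where
  lie_ef : ⁅e, f⁆ = h
  lie_he : ⁅h, e⁆ = (2 : ℂ) • e
  lie_hf : ⁅h, f⁆ = -((2 : ℂ) • f)
  e_zero : act φ e (gen t 0) = 0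
  e_one : act φ e (gen t 1) = gen t 0
  f_zero : act φ f (gen t 0) = gen t 1
  f_one : act φ f (gen t 1) = 0
  h_zero : act φ h (gen t 0) = gen t 0
  h_one : act φ h (gen t 1) = -gen t 1

/-- The generators form a linear map `ℂ² → 𝔫` that is equivariant modulo the derived algebra, that
is, an element of `Hom(ℂ², 𝔫)` invariant modulo a submodule. Correcting it to an invariant one gives
new generators, and the corresponding automorphism is absorbed into `φ'`. -/
theorem exists_isStandardTriple [FiniteDimensional ℂ H] (φ : n ≃ₗ⁅ℂ⁆ N t) (ht : 1 ≤ t) {e f h : H}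
    (lie_ef : ⁅e, f⁆ = h) (lie_he : ⁅h, e⁆ = (2 : ℂ) • e) (lie_hf : ⁅h, f⁆ = -((2 : ℂ) • f))
    (he : actMatrix φ ht e = !![0, 1; 0, 0]) (hf : actMatrix φ ht f = !![0, 0; 1, 0])
    (hh : actMatrix φ ht h = !![1, 0; 0, -1]) :
    ∃ φ' : n ≃ₗ⁅ℂ⁆ N t, IsStandardTriple φ' e f h := by
  have : FiniteDimensional ℂ (N t) := φ.toLinearEquiv.finiteDimensional
  have h_ef : ∀ a, act φ e (act φ f a) = act φ f (act φ e a) + act φ h a := fun a => by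
    rw [← lie_ef, LieHom.map_lie, LieDerivation.lie_apply, add_sub_cancel]
  have h_he : ∀ a, act φ h (act φ e a) = act φ e (act φ h a) + (2 : ℂ) • act φ e a := fun a => by
    rw [← LieDerivation.smul_apply, ← map_smul, ← lie_he, LieHom.map_lie, LieDerivation.lie_apply,
      add_sub_cancel]
  have h_hf : ∀ a, act φ h (act φ f a) = act φ f (act φ h a) - (2 : ℂ) • act φ f a := fun a => by
    rw [← LieDerivation.smul_apply, ← map_smul, ← neg_neg ((2 : ℂ) • f), ← lie_hf, map_neg,
      LieHom.map_lie, LieDerivation.neg_apply, LieDerivation.lie_apply, sub_neg_eq_add,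
      add_sub_cancel]
  let p₁ : N t × N t →ₗ[ℂ] N t := LinearMap.fst ℂ (N t) (N t)
  let p₂ : N t × N t →ₗ[ℂ] N t := LinearMap.snd ℂ (N t) (N t)
  let De : N t →ₗ[ℂ] N t := act φ e
  let Df : N t →ₗ[ℂ] N t := act φ f
  let Dh : N t →ₗ[ℂ] N t := act φ h
  -- A pair holds the images of the two basis vectors of `ℂ²`; the action is `T ↦ x ∘ T - T ∘ x`,
  -- with the standard matrices on `ℂ²`.
  have r : Sl2Rel (V := N t × N t) ((Dh ∘ₗ p₁ - p₁).prod (Dh ∘ₗ p₂ + p₂))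
      ((De ∘ₗ p₁).prod (De ∘ₗ p₂ - p₁)) ((Df ∘ₗ p₁ - p₂).prod (Df ∘ₗ p₂)) := by
    refine ⟨fun v => Prod.ext ?_ ?_, fun v => Prod.ext ?_ ?_, fun v => Prod.ext ?_ ?_⟩
    · change act φ e (act φ f v.1 - v.2) =
        (act φ f (act φ e v.1) - (act φ e v.2 - v.1)) + (act φ h v.1 - v.1)
      rw [map_sub, h_ef]
      abel
    · change act φ e (act φ f v.2) - (act φ f v.1 - v.2) =
        act φ f (act φ e v.2 - v.1) + (act φ h v.2 + v.2)
      rw [map_sub, h_ef]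
      abel
    · change act φ h (act φ e v.1) - act φ e v.1 =
        act φ e (act φ h v.1 - v.1) + (2 : ℂ) • act φ e v.1
      rw [map_sub, h_he]
      abel
    · change act φ h (act φ e v.2 - v.1) + (act φ e v.2 - v.1) =
        (act φ e (act φ h v.2 + v.2) - (act φ h v.1 - v.1)) + (2 : ℂ) • (act φ e v.2 - v.1)
      rw [map_sub, map_add, h_he]
      module
    · change act φ h (act φ f v.1 - v.2) - (act φ f v.1 - v.2) =
        (act φ f (act φ h v.1 - v.1) - (act φ h v.2 + v.2)) - (2 : ℂ) • (act φ f v.1 - v.2)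
      rw [map_sub, map_sub, h_hf]
      module
    · change act φ h (act φ f v.2) + act φ f v.2 =
        act φ f (act φ h v.2 + v.2) - (2 : ℂ) • act φ f v.2
      rw [map_add, h_hf]
      abel
  let U : Submodule ℂ (N t × N t) := (lcs t 1).toSubmodule.prod (lcs t 1).toSubmodule
  have hD : ∀ (x : H) (a : N t), a ∈ lcs t 1 → act φ x a ∈ lcs t 1 := fun x => der_mem_lcs _ 1
  have hval : ∀ (x : H) (M : Matrix (Fin 2) (Fin 2) ℂ), actMatrix φ ht x = M → ∀ (j : Fin 2),
      act φ x (gen t j) - (M 0 j • gen t 0 + M 1 j • gen t 1) ∈ lcs t 1 := by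
    rintro x _ rfl j
    have h1 := sub_sect_proj_mem ht (act φ x (gen t j))
    rw [sect_apply] at h1
    exact h1
  have e0 : act φ e (gen t 0) ∈ lcs t 1 := by simpa using hval e _ he 0
  have e1 : act φ e (gen t 1) - gen t 0 ∈ lcs t 1 := by simpa using hval e _ he 1
  have f0 : act φ f (gen t 0) - gen t 1 ∈ lcs t 1 := by simpa using hval f _ hf 0
  have f1 : act φ f (gen t 1) ∈ lcs t 1 := by simpa using hval f _ hf 1
  have h0 : act φ h (gen t 0) - gen t 0 ∈ lcs t 1 := by simpa using hval h _ hh 0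
  have h1 : act φ h (gen t 1) + gen t 1 ∈ lcs t 1 := by simpa using hval h _ hh 1
  obtain ⟨w, hw, hw1, hw2, hw3⟩ := r.exists_invariant U
    (fun u hu => ⟨sub_mem (hD h _ hu.1) hu.1, add_mem (hD h _ hu.2) hu.2⟩)
    (fun u hu => ⟨hD e _ hu.1, sub_mem (hD e _ hu.2) hu.1⟩)
    (fun u hu => ⟨sub_mem (hD f _ hu.1) hu.2, hD f _ hu.2⟩)
    (x := (gen t 0, gen t 1)) ⟨h0, h1⟩ ⟨e0, e1⟩ ⟨f0, f1⟩
  let T : Fin 2 → N t := ![gen t 0 - w.1, gen t 1 - w.2]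
  have hT : ∀ i, T i - gen t i ∈ lcs t 1 := by
    intro i
    fin_cases i
    · change gen t 0 - w.1 - gen t 0 ∈ lcs t 1
      rw [sub_sub_cancel_left]
      exact neg_mem hw.1
    · change gen t 1 - w.2 - gen t 1 ∈ lcs t 1
      rw [sub_sub_cancel_left]
      exact neg_mem hw.2
  let ψ := genEquiv T hT
  have hact : ∀ (x : H) (a : N t), act (φ.trans ψ.symm) x a = ψ.symm (act φ x (ψ a)) :=
    fun _ _ => rfl
  have hψ0 : ψ (gen t 0) = T 0 := genEquiv_gen T hT 0
  have hψ1 : ψ (gen t 1) = T 1 := genEquiv_gen T hT 1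
  have hψ0' : ψ.symm (T 0) = gen t 0 := by rw [← hψ0, LieEquiv.symm_apply_apply]
  have hψ1' : ψ.symm (T 1) = gen t 1 := by rw [← hψ1, LieEquiv.symm_apply_apply]
  have eT0 : act φ e (T 0) = 0 := congrArg Prod.fst hw2
  have eT1 : act φ e (T 1) - T 0 = 0 := congrArg Prod.snd hw2
  have fT0 : act φ f (T 0) - T 1 = 0 := congrArg Prod.fst hw3
  have fT1 : act φ f (T 1) = 0 := congrArg Prod.snd hw3
  have hT0 : act φ h (T 0) - T 0 = 0 := congrArg Prod.fst hw1
  have hT1 : act φ h (T 1) + T 1 = 0 := congrArg Prod.snd hw1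
  refine ⟨φ.trans ψ.symm, lie_ef, lie_he, lie_hf, ?_, ?_, ?_, ?_, ?_, ?_⟩
  · rw [hact, hψ0, eT0, map_zero]
  · rw [hact, hψ1, sub_eq_zero.mp eT1, hψ0']
  · rw [hact, hψ0, sub_eq_zero.mp fT0, hψ1']
  · rw [hact, hψ1, fT1, map_zero]
  · rw [hact, hψ0, sub_eq_zero.mp hT0, hψ0']
  · rw [hact, hψ1, eq_neg_of_add_eq_zero_left hT1, map_neg, hψ1']

namespace IsStandardTriple

variable {φ : n ≃ₗ⁅ℂ⁆ N t} {e f h : H}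

theorem actMatrix_eq (ht : 1 ≤ t) (s : IsStandardTriple φ e f h) :
    actMatrix φ ht e = !![0, 1; 0, 0] ∧ actMatrix φ ht f = !![0, 0; 1, 0] ∧
      actMatrix φ ht h = !![1, 0; 0, -1] := by
  refine ⟨?_, ?_, ?_⟩ <;> ext i j <;> rw [actMatrix_apply, symbol_apply] <;> fin_cases j
  · simp [s.e_zero]; fin_cases i <;> rfl
  · simp [s.e_one, proj_gen]; fin_cases i <;> simp
  · simp [s.f_zero, proj_gen]; fin_cases i <;> simp
  · simp [s.f_one]; fin_cases i <;> rfl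
  · simp [s.h_zero, proj_gen]; fin_cases i <;> simp
  · simp [s.h_one, proj_gen]; fin_cases i <;> simp

/-- Membership in the derived algebra comes from `h = ⁅e, f⁆`, `e = ⁅h, e⁆ / 2` and `f = -⁅h, f⁆ /
2`. -/
theorem act_mem_derOneZero (s : IsStandardTriple φ e f h) :
    act φ e ∈ derOneZero t ∧ act φ f ∈ derOneZero t ∧ act φ h ∈ derOneZero t := by
  have key : ∀ x : H, (∀ i, act φ x (gen t i) ∈ homog t 1) → act φ x ∈ derOne t := by
    intro x hx a ha
    rw [homog_one] at ha
    refine (Submodule.span_le (p := (homog t 1).comap (act φ x : N t →ₗ[ℂ] N t))).mpr ?_ ha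
    rintro _ ⟨j, rfl⟩
    exact hx j
  have he : act φ e ∈ derOne t := key e fun i => by
    fin_cases i
    · change act φ e (gen t 0) ∈ homog t 1
      rw [s.e_zero]; exact zero_mem _
    · change act φ e (gen t 1) ∈ homog t 1
      rw [s.e_one]; exact gen_mem t 0
  have hf : act φ f ∈ derOne t := key f fun i => by
    fin_cases i
    · change act φ f (gen t 0) ∈ homog t 1
      rw [s.f_zero]; exact gen_mem t 1
    · change act φ f (gen t 1) ∈ homog t 1
      rw [s.f_one]; exact zero_mem _
  have hh : act φ h ∈ derOneZero t := by
    rw [← s.lie_ef, LieHom.map_lie]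
    exact lie_mem_derOneZero he hf
  have hh' := derOneZero_le t hh
  refine ⟨?_, ?_, hh⟩
  · have h1 : act φ e = (1 / 2 : ℂ) • ⁅act φ h, act φ e⁆ := by
      rw [← LieHom.map_lie, s.lie_he, map_smul, smul_smul]
      norm_num
    rw [h1]
    exact (derOneZero t).smul_mem _ (lie_mem_derOneZero hh' he)
  · have h1 : act φ f = (-1 / 2 : ℂ) • ⁅act φ h, act φ f⁆ := by
      rw [← LieHom.map_lie, s.lie_hf, ← neg_smul, map_smul, smul_smul]
      norm_num
    rw [h1]
    exact (derOneZero t).smul_mem _ (lie_mem_derOneZero hh' hf)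

end IsStandardTriple

end StandardTriple

/-! ### Isomorphisms with `𝔤_{2,t}` and `𝔤(δ)` -/

section Isomorphism

variable {t : ℕ} {H : Type*} [LieRing H] [LieAlgebra ℂ H] {n : LieIdeal ℂ H}
  {φ : n ≃ₗ⁅ℂ⁆ N t} {e f h : H}

/-- The linear map `Der_1^0 𝔫_{2,t} → H` determined by a triple. -/
def tripleMap (ht : 1 ≤ t) (e f h : H) : derOneZero t →ₗ[ℂ] H where
  toFun D := symbol ht D 0 0 • h + symbol ht D 0 1 • e + symbol ht D 1 0 • f
  map_add' D E := by
    have hDE : symbol ht ((D + E : derOneZero t) : Der t) = symbol ht D + symbol ht E :=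
      map_add (symbol ht) (D : Der t) E
    simp only [hDE, Matrix.add_apply]
    module
  map_smul' c D := by
    have hcD : symbol ht ((c • D : derOneZero t) : Der t) = c • symbol ht D :=
      map_smul (symbol ht) c (D : Der t)
    simp only [hcD, Matrix.smul_apply, smul_eq_mul, RingHom.id_apply]
    module

theorem tripleMap_apply (ht : 1 ≤ t) (D : derOneZero t) : tripleMap ht e f h D =
    symbol ht D 0 0 • h + symbol ht D 0 1 • e + symbol ht D 1 0 • f := rfl

theorem symbol_one_one_of_mem (ht : 1 ≤ t) (D : derOneZero t) :
    symbol ht (D : Der t) 1 1 = -symbol ht (D : Der t) 0 0 := by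
  have h1 := trace_symbol_of_mem_derOneZero ht D.2
  rw [Matrix.trace_fin_two] at h1
  exact eq_neg_of_add_eq_zero_right h1

/-- A derivation in `Der_1` is determined by its matrix, and for one in `Der_1^0` the trace is zero,
so three coefficients suffice. -/
theorem act_tripleMap (ht : 1 ≤ t) (s : IsStandardTriple φ e f h) (D : derOneZero t) :
    act φ (tripleMap ht e f h D) = D := by
  have h1 := (mem_derOne_iff ht).mp (derOneZero_le t D.2)
  have h2 := symbol_one_one_of_mem ht D
  refine der_ext fun i => ?_
  rw [tripleMap_apply, map_add, map_add, map_smul, map_smul, map_smul]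
  simp only [LieDerivation.add_apply, LieDerivation.smul_apply]
  fin_cases i
  · change _ • act φ h (gen t 0) + _ • act φ e (gen t 0) + _ • act φ f (gen t 0) =
      (D : Der t) (gen t 0)
    rw [s.h_zero, s.e_zero, s.f_zero, h1 0, smul_zero, add_zero]
  · change _ • act φ h (gen t 1) + _ • act φ e (gen t 1) + _ • act φ f (gen t 1) =
      (D : Der t) (gen t 1)
    rw [s.h_one, s.e_one, s.f_one, h1 1, h2]
    module

theorem tripleMap_lie (ht : 1 ≤ t) (s : IsStandardTriple φ e f h) (D E : derOneZero t) :
    tripleMap ht e f h ⁅D, E⁆ = ⁅tripleMap ht e f h D, tripleMap ht e f h E⁆ := by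
  have hfe : ⁅f, e⁆ = -h := by rw [← lie_skew, s.lie_ef]
  have heh : ⁅e, h⁆ = -((2 : ℂ) • e) := by rw [← lie_skew, s.lie_he]
  have hfh : ⁅f, h⁆ = (2 : ℂ) • f := by rw [← lie_skew, s.lie_hf, neg_neg]
  simp only [tripleMap_apply, LieSubalgebra.coe_bracket, symbol_lie, Matrix.sub_apply,
    Matrix.mul_apply, Fin.sum_univ_two, symbol_one_one_of_mem, add_lie, lie_add, smul_lie, lie_smul,
    lie_self, s.lie_ef, s.lie_he, s.lie_hf, hfe, heh, hfh]
  module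

/-- The homomorphism `𝔤_{2,t} → H` determined by a standard triple. -/
def ofG (ht : 1 ≤ t) (s : IsStandardTriple φ e f h) : G t →ₗ⁅ℂ⁆ H where
  toFun p := (φ.symm p.left : H) + tripleMap ht e f h p.right
  map_add' p q := by
    change ((φ.symm (p.left + q.left) : n) : H) + tripleMap ht e f h (p.right + q.right) = _
    rw [map_add, map_add, LieSubmodule.coe_add]
    abel
  map_smul' c p := by
    change ((φ.symm (c • p.left) : n) : H) + tripleMap ht e f h (c • p.right) = _
    rw [map_smul, map_smul, LieSubmodule.coe_smul, RingHom.id_apply, smul_add]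
  map_lie' {p q} := by
    change ((φ.symm (⁅p.left, q.left⁆ + (p.right : Der t) q.left - (q.right : Der t) p.left) : n) : H) +
      tripleMap ht e f h ⁅p.right, q.right⁆ = ⁅(φ.symm p.left : H) + tripleMap ht e f h p.right,
        (φ.symm q.left : H) + tripleMap ht e f h q.right⁆
    rw [tripleMap_lie ht s, add_lie, lie_add, lie_add, lie_symm_apply, lie_symm_apply,
      ← lie_skew (φ.symm p.left : H), lie_symm_apply, act_tripleMap ht s, act_tripleMap ht s,
      map_sub, map_add, LieSubmodule.coe_sub, LieSubmodule.coe_add, act_coe,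
      LieEquiv.apply_symm_apply]
    abel

theorem ofG_apply (ht : 1 ≤ t) (s : IsStandardTriple φ e f h) (p : G t) :
    ofG ht s p = (φ.symm p.left : H) + tripleMap ht e f h p.right := rfl

theorem actMatrix_ofG (ht : 1 ≤ t) (s : IsStandardTriple φ e f h) (p : G t) :
    actMatrix φ ht (ofG ht s p) = symbol ht (p.right : Der t) := by
  rw [ofG_apply, map_add, actMatrix_eq_zero_of_mem φ ht (φ.symm p.left).2, zero_add,
    actMatrix_apply, act_tripleMap ht s]

theorem ofG_injective (ht : 1 ≤ t) (s : IsStandardTriple φ e f h) :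
    Function.Injective (ofG ht s) := by
  rw [injective_iff_map_eq_zero]
  intro p hp
  have h1 : symbol ht (p.right : Der t) = 0 := by
    rw [← actMatrix_ofG ht s, hp, map_zero]
  have h2 : tripleMap ht e f h p.right = 0 := by
    rw [tripleMap_apply, h1]
    simp
  have h3 : p.right = 0 := by
    apply Subtype.ext
    rw [← act_tripleMap ht s, h2, map_zero]
    rfl
  rw [ofG_apply, h2, add_zero] at hp
  have h4 : φ.symm p.left = φ.symm 0 := by
    rw [map_zero]
    exact Subtype.ext hp
  exact SemiDirectSum.ext (φ.symm.injective h4) h3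

/-- Subtracting the combination of `e, f, h` with the same matrix leaves an element of `n`. -/
theorem exists_ofG_eq (ht : 1 ≤ t) (s : IsStandardTriple φ e f h)
    (hker : ∀ x, actMatrix φ ht x = 0 → x ∈ n) {y : H} (hy : (actMatrix φ ht y).trace = 0) :
    ∃ p, ofG ht s p = y := by
  obtain ⟨he, hf, hh⟩ := s.act_mem_derOneZero
  let A := actMatrix φ ht y
  let D : derOneZero t := A 0 0 • ⟨act φ h, hh⟩ + A 0 1 • ⟨act φ e, he⟩ + A 1 0 • ⟨act φ f, hf⟩
  have hD : (D : Der t) = act φ (A 0 0 • h + A 0 1 • e + A 1 0 • f) := by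
    rw [map_add, map_add, map_smul, map_smul, map_smul]
    rfl
  have h1 : y - tripleMap ht e f h D ∈ n := by
    apply hker
    rw [map_sub, actMatrix_apply φ ht (tripleMap ht e f h D), act_tripleMap ht s, hD,
      ← actMatrix_apply, map_add, map_add, map_smul, map_smul, map_smul, (s.actMatrix_eq ht).1,
      (s.actMatrix_eq ht).2.1, (s.actMatrix_eq ht).2.2, sub_eq_zero]
    rw [Matrix.trace_fin_two] at hy
    ext i j
    fin_cases i <;> fin_cases j <;> simp [A]
    exact eq_neg_of_add_eq_zero_right hy
  refine ⟨⟨φ ⟨_, h1⟩, D⟩, ?_⟩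
  rw [ofG_apply, LieEquiv.symm_apply_apply]
  exact sub_add_cancel _ _

/-- The homomorphism `𝔤(δ) → H` determined by a standard triple and an element that commutes with
it. -/
def ofGDelta (ht : 1 ≤ t) (s : IsStandardTriple φ e f h) {x : H} (xe : ⁅x, e⁆ = 0) (xf : ⁅x, f⁆ = 0)
    (xh : ⁅x, h⁆ = 0) {δ : Der t} (hδ : Centralizes t δ) (hx : act φ x = idDer t + δ) :
    GDelta t δ hδ →ₗ⁅ℂ⁆ H where
  toFun p := ofG ht s p.1 + p.2 • x
  map_add' p q := by
    change ofG ht s (p.1 + q.1) + (p.2 + q.2) • x = _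
    rw [map_add, add_smul]
    abel
  map_smul' c p := by
    change ofG ht s (c • p.1) + (c * p.2) • x = c • (ofG ht s p.1 + p.2 • x)
    rw [map_smul, mul_smul, smul_add]
  map_lie' {p q} := by
    have key : ∀ q : G t, ⁅x, ofG ht s q⁆ =
        ofG ht s (liftDer t (idDer t + δ) (centralizes_add (idDer_centralizes t) hδ) q) := by
      intro q
      have h1 : ofG ht s (liftDer t (idDer t + δ) (centralizes_add (idDer_centralizes t) hδ) q) =
          (φ.symm ((idDer t + δ) q.left) : H) + tripleMap ht e f h 0 := rfl
      rw [h1, ofG_apply, lie_add, lie_symm_apply, hx, tripleMap_apply, lie_add, lie_add, lie_smul,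
        lie_smul, lie_smul, xe, xf, xh, map_zero, smul_zero, smul_zero, smul_zero, add_zero,
        add_zero]
    change ofG ht s (⁅p.1, q.1⁆ + p.2 • liftDer t _ _ q.1 - q.2 • liftDer t _ _ p.1) + (0 : ℂ) • x =
      ⁅ofG ht s p.1 + p.2 • x, ofG ht s q.1 + q.2 • x⁆
    rw [map_sub, map_add, map_smul, map_smul, ← key, ← key, LieHom.map_lie, add_lie, lie_add, lie_add,
      smul_lie, lie_smul, smul_lie, lie_smul, lie_self, ← lie_skew (ofG ht s p.1) x, smul_neg]
    simp only [smul_zero, zero_smul]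
    abel

theorem ofGDelta_bijective (ht : 1 ≤ t) (s : IsStandardTriple φ e f h)
    (hker : ∀ x, actMatrix φ ht x = 0 → x ∈ n) {x : H} (xe : ⁅x, e⁆ = 0)
    (xf : ⁅x, f⁆ = 0) (xh : ⁅x, h⁆ = 0) {δ : Der t} (hδ : Centralizes t δ)
    (hx : act φ x = idDer t + δ) (hx1 : actMatrix φ ht x = 1) :
    Function.Bijective (ofGDelta ht s xe xf xh hδ hx) := by
  have htr : ∀ p : G t, (actMatrix φ ht (ofG ht s p)).trace = 0 := fun p => by
    rw [actMatrix_ofG]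
    exact trace_symbol_of_mem_derOneZero ht p.right.2
  constructor
  · rw [injective_iff_map_eq_zero]
    intro p hp
    have h0 : ofG ht s p.1 + p.2 • x = 0 := hp
    have h1 : p.2 = 0 := by
      have h2 := congrArg (fun y => (actMatrix φ ht y).trace) h0
      simp only [map_add, map_smul, Matrix.trace_add, Matrix.trace_smul, htr, hx1, map_zero,
        Matrix.trace_zero, zero_add, Matrix.trace_one] at h2
      simpa using h2
    rw [h1, zero_smul, add_zero] at h0
    exact Prod.ext ((injective_iff_map_eq_zero _).mp (ofG_injective ht s) _ h0) h1
  · intro y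
    -- The image of `𝔤_{2,t}` acts with trace 0 and `x` with trace 2, so the trace determines the
    -- coefficient of `x`.
    let c : ℂ := (actMatrix φ ht y).trace / 2
    obtain ⟨p, hp⟩ := exists_ofG_eq ht s hker (y := y - c • x) (by
      rw [map_sub, map_smul, hx1, Matrix.trace_sub, Matrix.trace_smul, Matrix.trace_one]
      simp [c])
    refine ⟨((p, c) : G t × ℂ), ?_⟩
    change ofG ht s p + c • x = y
    rw [hp, sub_add_cancel]

end Isomorphism

/-! ### Classification when the nilradical contains its centralizer -/

section SelfCentralizing

variable {t : ℕ} {H : Type*} [LieRing H] [LieAlgebra ℂ H] [FiniteDimensional ℂ H]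
  {n : LieIdeal ℂ H}

theorem isNilpotent_N (t : ℕ) : LieRing.IsNilpotent (N t) :=
  (LieModule.isNilpotent_iff ℂ _ _).mpr ⟨t, lowerCentralSeries_eq_bot t⟩

theorem exists_standard_triple_of_not_isSolvable (ht : 1 ≤ t)
    (hn : ∀ I : LieIdeal ℂ H, LieRing.IsNilpotent I → I ≤ n)
    (hcen : ∀ x : H, (∀ y ∈ n, ⁅x, y⁆ = 0) → x ∈ n) (φ : n ≃ₗ⁅ℂ⁆ N t)
    (hH : ¬ IsSolvable H) : ∃ (φ' : n ≃ₗ⁅ℂ⁆ N t) (e f h : H), IsStandardTriple φ' e f h := by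
  have hker : ∀ x, actMatrix φ ht x = 0 → x ∈ n := fun x =>
    (actMatrix_eq_zero_iff φ ht hcen hn).mp
  have : LieRing.IsNilpotent n := by
    have := isNilpotent_N t
    exact φ.injective.lieAlgebra_isNilpotent
  have hex := fun M (hM : M.trace = 0) =>
    exists_map_eq_of_not_isSolvable (actMatrix_lie φ ht) hker hH (M := M) hM
  obtain ⟨e, he⟩ := hex !![0, 1; 0, 0] (by simp [Matrix.trace_fin_two])
  obtain ⟨f, hf⟩ := hex !![0, 0; 1, 0] (by simp [Matrix.trace_fin_two])
  obtain ⟨h, hh⟩ := hex !![1, 0; 0, -1] (by simp [Matrix.trace_fin_two])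
  have r1 : ⁅e, f⁆ - h ∈ n := hker _ (by
    rw [map_sub, actMatrix_lie, he, hf, hh]
    ext i j
    fin_cases i <;> fin_cases j <;> simp)
  have r2 : ⁅h, e⁆ - (2 : ℂ) • e ∈ n := hker _ (by
    rw [map_sub, map_smul, actMatrix_lie, he, hh]
    ext i j
    fin_cases i <;> fin_cases j <;> simp
    norm_num)
  have r3 : ⁅h, f⁆ + (2 : ℂ) • f ∈ n := hker _ (by
    rw [map_add, map_smul, actMatrix_lie, hf, hh]
    ext i j
    fin_cases i <;> fin_cases j <;> simp
    norm_num)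
  obtain ⟨e', f', h', hee, hff, hhh, l1, l2, l3⟩ := exists_sl2_lift (lcsIdeal_zero φ)
    (lcsIdeal_succ_le φ) (lie_lcsIdeal_le φ) (lcsIdeal_eq_bot φ) r1 r2 r3
  have hmod : ∀ {x y : H}, x - y ∈ n → actMatrix φ ht x = actMatrix φ ht y := fun hxy => by
    rw [← sub_eq_zero, ← map_sub]
    exact actMatrix_eq_zero_of_mem φ ht hxy
  obtain ⟨φ', s⟩ := exists_isStandardTriple φ ht l1 l2 l3 ((hmod hee).trans he)
    ((hmod hff).trans hf) ((hmod hhh).trans hh)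
  exact ⟨φ', e', f', h', s⟩

theorem symbol_idDer (ht : 1 ≤ t) : symbol ht (idDer t) = 1 := by
  ext i j
  rw [symbol_apply, idDer, extendDer_gen, proj_gen, Matrix.one_apply, Pi.single_apply]

/-- If some element does not act with trace zero, then some element commutes with the standard
triple and acts as the identity on the abelianization. -/
theorem exists_commuting_of_trace_ne_zero (ht : 1 ≤ t) {φ : n ≃ₗ⁅ℂ⁆ N t}
    (hker : ∀ x, actMatrix φ ht x = 0 → x ∈ n) {e f h : H} (s : IsStandardTriple φ e f h) {y : H}
    (hy : (actMatrix φ ht y).trace ≠ 0) :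
    ∃ x, ⁅x, e⁆ = 0 ∧ ⁅x, f⁆ = 0 ∧ ⁅x, h⁆ = 0 ∧ actMatrix φ ht x = 1 := by
  obtain ⟨Ae, Af, Ah⟩ := s.actMatrix_eq ht
  let A := actMatrix φ ht y
  let c := A.trace / 2
  have hc : c ≠ 0 := div_ne_zero hy two_ne_zero
  -- Removing the traceless part of the matrix of `y` and rescaling gives an element with identity
  -- matrix. It is central modulo `n`, so `exists_invariant` can be applied to the adjoint action
  -- with `U = n`.
  let z := c⁻¹ • (y - (A 0 0 - c) • h - A 0 1 • e - A 1 0 • f)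
  have hz : actMatrix φ ht z = 1 := by
    have h1 : A - (A 0 0 - c) • !![1, 0; 0, -1] - A 0 1 • !![0, 1; 0, 0] - A 1 0 • !![0, 0; 1, 0] =
        c • (1 : Matrix (Fin 2) (Fin 2) ℂ) := by
      have hc2 : c = (A 0 0 + A 1 1) / 2 := by
        simp only [c, Matrix.trace_fin_two]
      ext i j
      fin_cases i <;> fin_cases j <;> simp [hc2]
      ring
    rw [map_smul, map_sub, map_sub, map_sub, map_smul, map_smul, map_smul, Ae, Af, Ah]
    change c⁻¹ • (A - _ - _ - _) = 1
    rw [h1, smul_smul, inv_mul_cancel₀ hc, one_smul]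
  have hzn : ∀ x, ⁅x, z⁆ ∈ n := fun x => hker _ (by
    rw [actMatrix_lie, hz, mul_one, one_mul, sub_self])
  have r : Sl2Rel (ad ℂ H h) (ad ℂ H e) (ad ℂ H f) := by
    refine ⟨fun v => ?_, fun v => ?_, fun v => ?_⟩ <;> simp only [ad_apply]
    · rw [leibniz_lie, s.lie_ef, add_comm]
    · rw [leibniz_lie, s.lie_he, smul_lie, add_comm]
    · rw [leibniz_lie, s.lie_hf, neg_lie, smul_lie, add_comm, sub_eq_add_neg]
  obtain ⟨w, hw, hh, he, hf⟩ := r.exists_invariant n.toSubmodule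
    (fun u hu => lie_mem_right ℂ H n h u hu) (fun u hu => lie_mem_right ℂ H n e u hu)
    (fun u hu => lie_mem_right ℂ H n f u hu) (hzn h) (hzn e) (hzn f)
  rw [ad_apply, ← lie_skew, neg_eq_zero] at hh he hf
  exact ⟨z - w, he, hf, hh, by rw [map_sub, hz, actMatrix_eq_zero_of_mem φ ht hw, sub_zero]⟩

/-- The classification of the Lie algebras in which an ideal isomorphic to `𝔫_{2,t}` contains its
centralizer and every nilpotent ideal. -/
theorem classification_of_self_centralizing (ht : 1 ≤ t)
    (hn : ∀ I : LieIdeal ℂ H, LieRing.IsNilpotent I → I ≤ n)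
    (hcen : ∀ x : H, (∀ y ∈ n, ⁅x, y⁆ = 0) → x ∈ n) (φ₀ : n ≃ₗ⁅ℂ⁆ N t) :
    IsSolvable H ∨ Nonempty (H ≃ₗ⁅ℂ⁆ G t) ∨
      ∃ (δ : Der t) (hδ : Centralizes t δ), δ ∈ nilDer t ∧ Nonempty (H ≃ₗ⁅ℂ⁆ GDelta t δ hδ) := by
  by_cases hH : IsSolvable H
  · exact Or.inl hH
  right
  obtain ⟨φ, e, f, h, s⟩ := exists_standard_triple_of_not_isSolvable ht hn hcen φ₀ hH
  have hker : ∀ x, actMatrix φ ht x = 0 → x ∈ n := fun x =>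
    (actMatrix_eq_zero_iff φ ht hcen hn).mp
  by_cases htr : ∀ y, (actMatrix φ ht y).trace = 0
  · left
    exact ⟨(LieEquiv.ofBijective (ofG ht s)
      ⟨ofG_injective ht s, fun y => exists_ofG_eq ht s hker (htr y)⟩).symm⟩
  · right
    push Not at htr
    obtain ⟨y, hy⟩ := htr
    obtain ⟨x, xe, xf, xh, hx1⟩ := exists_commuting_of_trace_ne_zero ht hker s hy
    have hx : act φ x = idDer t + (act φ x - idDer t) := (add_sub_cancel _ _).symm
    -- The triple acts as all of `Der_1^0`, and `x` commutes with it.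
    have hδ : Centralizes t (act φ x - idDer t) := by
      intro d hd
      have hd' : act φ (tripleMap ht e f h ⟨d, hd⟩) = d := act_tripleMap ht s ⟨d, hd⟩
      rw [lie_sub, idDer_centralizes t d hd, sub_zero, ← hd',
        ← LieHom.map_lie, ← lie_skew, tripleMap_apply, lie_add, lie_add, lie_smul, lie_smul,
        lie_smul, xe, xf, xh]
      simp
    refine ⟨_, hδ, mem_nilDer ((symbol_eq_zero_iff ht _).mp ?_),
      ⟨(LieEquiv.ofBijective _ (ofGDelta_bijective ht s hker xe xf xh hδ hx hx1)).symm⟩⟩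
    rw [map_sub, symbol_idDer, ← actMatrix_apply, hx1, sub_self]

end SelfCentralizing

/-! ### Ideals of a direct summand -/

section Summand

variable {g : Type*} [LieRing g] [LieAlgebra ℂ g]

/-- An ideal of a direct summand, as an ideal of the whole Lie algebra. -/
def idealOfSummand {S H : LieIdeal ℂ g} (hSH : IsCompl S H) (I : LieIdeal ℂ H) : LieIdeal ℂ g where
  carrier := {x | ∃ hx : x ∈ H, ⟨x, hx⟩ ∈ I}
  add_mem' := fun ⟨ha, ha'⟩ ⟨hb, hb'⟩ => ⟨add_mem ha hb, add_mem ha' hb'⟩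
  zero_mem' := ⟨zero_mem _, zero_mem I⟩
  smul_mem' := fun c _ ⟨ha, ha'⟩ => ⟨SMulMemClass.smul_mem c ha, SMulMemClass.smul_mem c ha'⟩
  lie_mem := fun {y x} ⟨hx, hx'⟩ => by
    obtain ⟨s, hs, k, hk, rfl⟩ := (LieSubmodule.mem_sup S H y).mp (hSH.sup_eq_top ▸ LieSubmodule.mem_top y)
    have h1 : ⁅s, x⁆ = 0 := by
      rw [← LieSubmodule.mem_bot (R := ℂ) (L := g), ← hSH.inf_eq_bot]
      exact ⟨lie_mem_left ℂ g S s x hs, lie_mem_right ℂ g H s x hx⟩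
    refine ⟨lie_mem_right ℂ g H _ _ hx, ?_⟩
    have h2 := lie_mem_right ℂ H I ⟨k, hk⟩ ⟨x, hx⟩ hx'
    have h3 : (⟨⁅s + k, x⁆, lie_mem_right ℂ g H _ _ hx⟩ : H) = ⁅(⟨k, hk⟩ : H), (⟨x, hx⟩ : H)⁆ :=
      Subtype.ext (by
        change ⁅s + k, x⁆ = ⁅k, x⁆
        rw [add_lie, h1, zero_add])
    exact h3 ▸ h2

theorem isNilpotent_idealOfSummand {S H : LieIdeal ℂ g} (hSH : IsCompl S H) (I : LieIdeal ℂ H)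
    [LieRing.IsNilpotent I] : LieRing.IsNilpotent (idealOfSummand hSH I) := by
  let q : idealOfSummand hSH I →ₗ⁅ℂ⁆ I :=
    { toFun := fun x => ⟨⟨x, x.2.1⟩, x.2.2⟩
      map_add' := fun _ _ => rfl
      map_smul' := fun _ _ => rfl
      map_lie' := rfl }
  have hq : Function.Injective q := fun x y hxy =>
    Subtype.ext (congrArg (fun z : I => ((z : H) : g)) hxy)
  exact hq.lieAlgebra_isNilpotent

/-- An ideal contained in another ideal, as an ideal of the latter, is isomorphic to itself. -/
def comapInclEquiv {n H : LieIdeal ℂ g} (h : n ≤ H) : n.comap H.incl ≃ₗ⁅ℂ⁆ n where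
  toFun x := ⟨x.1, x.2⟩
  map_add' _ _ := rfl
  map_smul' _ _ := rfl
  map_lie' := rfl
  invFun x := ⟨⟨x, h x.2⟩, x.2⟩
  left_inv _ := rfl
  right_inv _ := rfl

end Summand

end FreeNilExt

end

/-! ### Assembly of the classification -/

theorem mainTheorem5 (t : ℕ) (ht : 1 ≤ t) (g : Type*) [LieRing g] [LieAlgebra ℂ g]
    [FiniteDimensional ℂ g] (hns : ¬ LieAlgebra.IsSolvable g)
    (hnil : Nonempty (FreeNilExt.nilradical g ≃ₗ⁅ℂ⁆ FreeNilExt.N t)) :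
    (∃ S R : LieIdeal ℂ g, IsCompl S R ∧ S ≠ ⊥ ∧ LieAlgebra.IsSemisimple ℂ S ∧
        LieAlgebra.IsSolvable R ∧ Nonempty (FreeNilExt.nilradical R ≃ₗ⁅ℂ⁆ FreeNilExt.N t)) ∨
      (∃ S H : LieIdeal ℂ g, IsCompl S H ∧ LieAlgebra.IsSemisimple ℂ S ∧
        Nonempty (H ≃ₗ⁅ℂ⁆ FreeNilExt.G t)) ∨
      (∃ S H : LieIdeal ℂ g, IsCompl S H ∧ LieAlgebra.IsSemisimple ℂ S ∧
        ∃ (δ : FreeNilExt.Der t) (hδ : FreeNilExt.Centralizes t δ), δ ∈ FreeNilExt.nilDer t ∧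
          Nonempty (H ≃ₗ⁅ℂ⁆ FreeNilExt.GDelta t δ hδ)) := by
  obtain ⟨φ⟩ := hnil
  have hn : ∀ I : LieIdeal ℂ g, LieRing.IsNilpotent I → I ≤ FreeNilExt.nilradical g :=
    fun I hI => le_sSup hI
  obtain ⟨S, H, hSH, hS, hnH, hcen⟩ := FreeNilExt.exists_isCompl_of_forall_isNilpotent_le hn
  let m : LieIdeal ℂ H := (FreeNilExt.nilradical g).comap H.incl
  let ψ : m ≃ₗ⁅ℂ⁆ FreeNilExt.N t := (FreeNilExt.comapInclEquiv hnH).trans φ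
  have hm : ∀ I : LieIdeal ℂ H, LieRing.IsNilpotent I → I ≤ m := fun I hI x hx =>
    hn _ (FreeNilExt.isNilpotent_idealOfSummand hSH I) ⟨x.2, hx⟩
  have hmcen : ∀ x : H, (∀ y ∈ m, ⁅x, y⁆ = 0) → x ∈ m := fun x hx =>
    hcen x x.2 fun y hy => congrArg Subtype.val (hx ⟨y, hnH hy⟩ hy)
  rcases FreeNilExt.classification_of_self_centralizing ht hm hmcen ψ with h | h | h
  · left
    refine ⟨S, H, hSH, ?_, hS, h, ?_⟩
    -- If `S` were zero, `g` would equal the solvable summand `H`.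
    · rintro rfl
      have hT : H = ⊤ := by
        have := hSH.sup_eq_top
        rwa [bot_sup_eq] at this
      subst hT
      exact hns ((LieAlgebra.solvable_iff_equiv_solvable (R := ℂ) LieSubalgebra.topEquiv).mp h)
    -- The ideal `m` is nilpotent, being isomorphic to `𝔫_{2,t}`, and contains every nilpotent ideal
    -- of `H`.
    · have hmn : FreeNilExt.nilradical H = m := by
        refine le_antisymm (sSup_le hm) (le_sSup ?_)
        have := FreeNilExt.isNilpotent_N t
        exact ψ.injective.lieAlgebra_isNilpotent
      rw [hmn]
      exact ⟨ψ⟩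
  · exact Or.inr (Or.inl ⟨S, H, hSH, hS, h⟩)
  · exact Or.inr (Or.inr ⟨S, H, hSH, hS, h⟩)
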